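/- **Conventions.** All Lie algebras are real and finite-dimensional. Let $\mathfrak g$ be a Lie algebra with a nondegenerate symmetric bilinear form $\langle\,,\rangle$ (an inner product). Its Levi-Civita product $u.v=\mathrm L_uv=\mathrm R_vu$ is defined by $$2\langle u.v,w\rangle=\langle[u,v],w\rangle+\langle[w,u],v\rangle+\langle[w,v],u\rangle .$$ The pair $(\mathfrak g,\langle\,,\rangle)$ is *flat* if $\mathrm L_{[u,v]}=[\mathrm L_u,\mathrm L_v]$ for all $u,v$; it is *Riemannian* if $\langle\,,\rangle$ is positive definite, *Lorentzian* if $\langle\,,\rangle$ has signature $(-,+,\dots,+)$. The *modular vector* $\mathbf h\in\mathfrak g$ is defined by $\langle\mathbf h,u\rangle=\mathrm{tr}(\mathrm{ad}_u)$ for all $u$; $\mathfrak g$ is *unimodular* if $\mathrm{tr}(\mathrm{ad}_u)=0$ for all $u$. Put $H=\mathrm{span}\{\mathbf h\}$, and let $H^\perp$ be its orthogonal. Let $(B,[\,,]_0,\langle\,,\rangle_0)$ be a flat Lie algebra with inner product, $\xi,D\in\mathrm{End}(B)$, $\mu\in\mathbb R$, $b_0\in B$. The quadruple $(\xi,D,\mu,b_0)$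 is *admissible* if $D-\xi$ is skew-symmetric, $[D,\xi]=\xi^2-\mu\xi-\mathrm R_{b_0}$, and for all $a,b\in B$ $$\xi([a,b]_0)=a.\xi(b)-b.\xi(a),\qquad a.\xi(b)-\xi(a.b)=D(a).b+a.D(b)-D(a.b),$$ where the products are Levi-Civita products of $B$. The *double extension* of $B$ according to $(\xi,D,\mu,b_0)$ is the Lie algebra with underlying vector space $\mathbb Re\oplus B\oplus\mathbb R\bar e$ and with bracket, for $a,b\in B$, $$[\bar e,e]=\mu e,\quad[\bar e,a]=D(a)-\langle b_0,a\rangle_0e,\quad[e,a]=0,\quad[a,b]=[a,b]_0+\langle(\xi-\xi^*)(a),b\rangle_0e,$$ where $\xi^*$ is the $\langle\,,\rangle_0$-adjoint of $\xi$, equipped with the inner product that extends $\langle\,,\rangle_0$, for which $\mathrm{span}\{e,\bar e\}\perp B$, $\langle e,e\rangle=\langle\bar e,\bar e\rangle=0$ and $\langle e,\bar e\rangle=1$. **Theorem 1.1.** Let $(\mathfrak g,\langle\,,\rangle)$ be a nonunimodular Lorentzian flat Lie algebra. Then: (i) $\mathrm L_{\mathbf h}=0$, and both $H$ and $H^\perp$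 are two-sided ideals of $\mathfrak g$ with respect to the Levi-Civita product. (ii) $(\mathfrak g,\langle\,,\rangle)$ is isomorphic, by an isometric Lie algebra isomorphism, to the double extension of a Riemannian flat Lie algebra $(B,[\,,]_0,\langle\,,\rangle_0)$ according to some admissible $(\xi,D,\mu,b_0)$ with $\mathrm{tr}(D)\neq-\mu$. -/

import Mathlib

universe u

namespace FlatLie

/-- A pseudo-Euclidean inner product: a nondegenerate symmetric bilinear form. -/
structure Metric (V : Type u) [AddCommGroup V] [Module ℝ V] where
  form : LinearMap.BilinForm ℝ V
  symm : ∀ x y, form x y = form y x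
  nondegenerate : form.Nondegenerate

namespace Metric

section VectorSpace

variable {V : Type u} [AddCommGroup V] [Module ℝ V] (m : Metric V)

/-- Positive definite inner product. -/
def IsRiemannian : Prop := ∀ x, x ≠ 0 → 0 < m.form x x

/-- Signature `(-,+,…,+)`: the index of negativity of the nondegenerate form is one. -/
def IsLorentzian : Prop := sigNeg m.form.toQuadraticMap = 1

/-- `f` is skew-symmetric with respect to the inner product. -/
def IsSkew (f : Module.End ℝ V) : Prop := ∀ x y, m.form (f x) y = -m.form x (f y)

/-- The adjoint of an endomorphism with respect to the inner product. -/
noncomputable def adjoint [FiniteDimensional ℝ V] (f : Module.End ℝ V) : Module.End ℝ V :=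
  m.form.leftAdjointOfNondegenerate m.nondegenerate f

theorem form_adjoint [FiniteDimensional ℝ V] (f : Module.End ℝ V) (x y : V) :
    m.form (m.adjoint f x) y = m.form x (f y) :=
  m.form.isAdjointPairLeftAdjointOfNondegenerate m.nondegenerate f x y

end VectorSpace

section LieAlgebra

variable {g : Type u} [LieRing g] [LieAlgebra ℝ g] (m : Metric g)

/-- The right-hand side `⟨[u,v],w⟩ + ⟨[w,u],v⟩ + ⟨[w,v],u⟩` of the Koszul formula. -/
def koszul (u v : g) : Module.Dual ℝ g where
  toFun w := m.form ⁅u, v⁆ w + m.form ⁅w, u⁆ v + m.form ⁅w, v⁆ u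
  map_add' w w' := by simp only [map_add, add_lie, LinearMap.add_apply]; ring
  map_smul' c w := by
    simp only [map_smul, smul_lie, LinearMap.smul_apply, smul_eq_mul, RingHom.id_apply]; ring

variable [FiniteDimensional ℝ g]

/-- The Levi-Civita product `u.v = L_u v`, i.e. the unique product such that
`2⟨u.v,w⟩ = ⟨[u,v],w⟩ + ⟨[w,u],v⟩ + ⟨[w,v],u⟩`. -/
noncomputable def L : g →ₗ[ℝ] Module.End ℝ g :=
  LinearMap.mk₂ ℝ
    (fun u v => (m.form.toDual m.nondegenerate).symm ((1 / 2 : ℝ) • m.koszul u v))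
    (fun u u' v => by
      rw [← map_add]; congr 1; ext w
      simp only [koszul, LinearMap.smul_apply, LinearMap.add_apply, LinearMap.coe_mk,
        AddHom.coe_mk, map_add, add_lie, lie_add, smul_eq_mul]; ring)
    (fun c u v => by
      rw [← map_smul]; congr 1; ext w
      simp only [koszul, LinearMap.smul_apply, LinearMap.coe_mk,
        AddHom.coe_mk, map_smul, smul_lie, lie_smul, smul_eq_mul]; ring)
    (fun u v v' => by
      rw [← map_add]; congr 1; ext w
      simp only [koszul, LinearMap.smul_apply, LinearMap.add_apply, LinearMap.coe_mk,
        AddHom.coe_mk, map_add, lie_add, smul_eq_mul]; ring)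
    (fun c u v => by
      rw [← map_smul]; congr 1; ext w
      simp only [koszul, LinearMap.smul_apply, LinearMap.coe_mk,
        AddHom.coe_mk, map_smul, lie_smul, smul_eq_mul]; ring)

theorem koszul_formula (u v w : g) :
    2 * m.form (m.L u v) w = m.form ⁅u, v⁆ w + m.form ⁅w, u⁆ v + m.form ⁅w, v⁆ u := by
  simp [L, koszul, LinearMap.BilinForm.apply_toDual_symm_apply]

/-- The right multiplication `R_u v = v.u`. -/
noncomputable def R (u : g) : Module.End ℝ g := m.L.flip u

/-- The curvature `K(u,v) = L_[u,v] - [L_u, L_v]`. -/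
noncomputable def curvature (u v : g) : Module.End ℝ g := m.L ⁅u, v⁆ - ⁅m.L u, m.L v⁆

def IsFlat : Prop := ∀ u v : g, m.curvature u v = 0

/-- The modular vector: the unique `h` with `⟨h,u⟩ = tr (ad u)` for all `u`. -/
noncomputable def modularVector : g :=
  (m.form.toDual m.nondegenerate).symm
    (LinearMap.trace ℝ g ∘ₗ (LieAlgebra.ad ℝ g : g →ₗ[ℝ] Module.End ℝ g))

theorem form_modularVector (u : g) :
    m.form m.modularVector u = LinearMap.trace ℝ g (LieAlgebra.ad ℝ g u) := by
  simp [modularVector, LinearMap.BilinForm.apply_toDual_symm_apply]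

/-- `I` is a two-sided ideal of `g` with respect to the Levi-Civita product. -/
def IsTwoSidedIdeal (I : Submodule ℝ g) : Prop :=
  ∀ u : g, ∀ x ∈ I, m.L u x ∈ I ∧ m.L x u ∈ I

theorem L_sub_L (u v : g) : m.L u v - m.L v u = ⁅u, v⁆ := by
  apply (m.form.toDual m.nondegenerate).injective
  ext w
  have h1 := m.koszul_formula u v w
  have h2 := m.koszul_formula v u w
  have h3 : m.form ⁅v, u⁆ w = -m.form ⁅u, v⁆ w := by
    rw [← lie_skew, map_neg, LinearMap.neg_apply]
  simp only [LinearMap.BilinForm.toDual_def, map_sub, LinearMap.sub_apply]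
  linarith

theorem L_skew (u : g) : m.IsSkew (m.L u) := by
  intro v w
  have h1 := m.koszul_formula u v w
  have h2 := m.koszul_formula u w v
  have h3 : m.form ⁅w, u⁆ v = -m.form ⁅u, w⁆ v := by
    rw [← lie_skew, map_neg, LinearMap.neg_apply]
  have h4 : m.form ⁅v, u⁆ w = -m.form ⁅u, v⁆ w := by
    rw [← lie_skew, map_neg, LinearMap.neg_apply]
  have h5 : m.form ⁅v, w⁆ u = -m.form ⁅w, v⁆ u := by
    rw [← lie_skew, map_neg, LinearMap.neg_apply]
  rw [m.symm v]
  linarith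

end LieAlgebra

end Metric

/-- A Lie algebra is unimodular if all its adjoint maps are traceless. -/
def IsUnimodular (g : Type u) [LieRing g] [LieAlgebra ℝ g] : Prop :=
  ∀ u : g, LinearMap.trace ℝ g (LieAlgebra.ad ℝ g u) = 0

/-- Admissible quadruples `(ξ, D, μ, b₀)` on a Lie algebra with an inner product. -/
structure AdmissibleData {B : Type u} [LieRing B] [LieAlgebra ℝ B] [FiniteDimensional ℝ B]
    (m : Metric B) where
  ξ : Module.End ℝ B
  D : Module.End ℝ B
  μ : ℝ
  b₀ : B
  /-- `ξ` is a 1-cocycle for the representation `L`. -/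
  cocycle : ∀ a b : B, ξ ⁅a, b⁆ = m.L a (ξ b) - m.L b (ξ a)
  skew : m.IsSkew (D - ξ)
  commutator : ⁅D, ξ⁆ = ξ ^ 2 - μ • ξ - m.R b₀
  compat : ∀ a b : B, m.L a (ξ b) - ξ (m.L a b) = m.L (D a) b + m.L a (D b) - D (m.L a b)

section DoubleExtension

variable {B : Type u} [LieRing B] [LieAlgebra ℝ B] [FiniteDimensional ℝ B] {m : Metric B}

/-- The vector space `ℝe ⊕ B ⊕ ℝē` underlying the double extension; the triple `(x, a, y)`
stands for `x e + a + y ē`. -/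
def DoubleExtension (_d : AdmissibleData m) : Type u := ℝ × B × ℝ

namespace DoubleExtension

variable (d : AdmissibleData m)

instance : AddCommGroup (DoubleExtension d) := inferInstanceAs (AddCommGroup (ℝ × B × ℝ))
instance : Module ℝ (DoubleExtension d) := inferInstanceAs (Module ℝ (ℝ × B × ℝ))
instance : FiniteDimensional ℝ (DoubleExtension d) :=
  inferInstanceAs (FiniteDimensional ℝ (ℝ × B × ℝ))

/-- The bilinear skew bracket with
`[ē,e] = μ e`, `[ē,a] = D a - ⟨b₀,a⟩ e`, `[a,b] = [a,b]₀ + ⟨(ξ - ξ*) a, b⟩ e`. -/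
noncomputable instance : Bracket (DoubleExtension d) (DoubleExtension d) where
  bracket p q :=
    (d.μ * (p.2.2 * q.1 - q.2.2 * p.1)
        - (p.2.2 * m.form d.b₀ q.2.1 - q.2.2 * m.form d.b₀ p.2.1)
        + m.form ((d.ξ - m.adjoint d.ξ) p.2.1) q.2.1,
      p.2.2 • d.D q.2.1 - q.2.2 • d.D p.2.1 + ⁅p.2.1, q.2.1⁆,
      0)

variable {d}

@[simp] theorem add_fst (p q : DoubleExtension d) : (p + q).1 = p.1 + q.1 := rfl
@[simp] theorem add_mid (p q : DoubleExtension d) : (p + q).2.1 = p.2.1 + q.2.1 := rfl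
@[simp] theorem add_snd (p q : DoubleExtension d) : (p + q).2.2 = p.2.2 + q.2.2 := rfl
@[simp] theorem smul_fst (c : ℝ) (p : DoubleExtension d) : (c • p).1 = c * p.1 := rfl
@[simp] theorem smul_mid (c : ℝ) (p : DoubleExtension d) : (c • p).2.1 = c • p.2.1 := rfl
@[simp] theorem smul_snd (c : ℝ) (p : DoubleExtension d) : (c • p).2.2 = c * p.2.2 := rfl
@[simp] theorem zero_fst : (0 : DoubleExtension d).1 = 0 := rfl
@[simp] theorem zero_mid : (0 : DoubleExtension d).2.1 = 0 := rfl
@[simp] theorem zero_snd : (0 : DoubleExtension d).2.2 = 0 := rfl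

theorem ext' {p q : DoubleExtension d} (h1 : p.1 = q.1) (h2 : p.2.1 = q.2.1)
    (h3 : p.2.2 = q.2.2) : p = q := Prod.ext h1 (Prod.ext h2 h3)

@[simp] theorem lie_fst (p q : DoubleExtension d) : ⁅p, q⁆.1 =
    d.μ * (p.2.2 * q.1 - q.2.2 * p.1)
      - (p.2.2 * m.form d.b₀ q.2.1 - q.2.2 * m.form d.b₀ p.2.1)
      + (m.form (d.ξ p.2.1) q.2.1 - m.form p.2.1 (d.ξ q.2.1)) := by
  rw [← m.form_adjoint]
  simp [Bracket.bracket]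
@[simp] theorem lie_mid (p q : DoubleExtension d) : ⁅p, q⁆.2.1 =
    p.2.2 • d.D q.2.1 - q.2.2 • d.D p.2.1 + ⁅p.2.1, q.2.1⁆ := rfl
@[simp] theorem lie_snd (p q : DoubleExtension d) : ⁅p, q⁆.2.2 = 0 := rfl

variable (d)

/-- `D` is a derivation of `B`. -/
theorem derivation (a b : B) : d.D ⁅a, b⁆ = ⁅d.D a, b⁆ + ⁅a, d.D b⁆ := by
  have h1 := d.compat a b
  have h2 := d.compat b a
  have h3 := d.cocycle a b
  rw [← m.L_sub_L a b] at h3 ⊢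
  rw [← m.L_sub_L (d.D a), ← m.L_sub_L a]
  simp only [map_sub] at h3 ⊢
  have h4 : d.D (m.L a b) = m.L (d.D a) b + m.L a (d.D b) - (m.L a (d.ξ b) - d.ξ (m.L a b)) := by
    rw [h1]; abel
  have h5 : d.D (m.L b a) = m.L (d.D b) a + m.L b (d.D a) - (m.L b (d.ξ a) - d.ξ (m.L b a)) := by
    rw [h2]; abel
  rw [h4, h5]
  have h6 : d.ξ (m.L a b) = m.L a (d.ξ b) - m.L b (d.ξ a) + d.ξ (m.L b a) := by rw [← h3]; abel
  rw [h6]; abel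

theorem closed (a b c : B) :
    (m.form (d.ξ ⁅a, b⁆) c - m.form ⁅a, b⁆ (d.ξ c))
      + (m.form (d.ξ ⁅b, c⁆) a - m.form ⁅b, c⁆ (d.ξ a))
      + (m.form (d.ξ ⁅c, a⁆) b - m.form ⁅c, a⁆ (d.ξ b)) = 0 := by
  simp only [d.cocycle]
  rw [← m.L_sub_L a b, ← m.L_sub_L b c, ← m.L_sub_L c a]
  simp only [map_sub, LinearMap.sub_apply]
  have s1 := m.L_skew a (d.ξ b) c
  have s2 := m.L_skew a (d.ξ c) b
  have s3 := m.L_skew b (d.ξ a) c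
  have s4 := m.L_skew b (d.ξ c) a
  have s5 := m.L_skew c (d.ξ a) b
  have s6 := m.L_skew c (d.ξ b) a
  have t1 := m.symm (m.L a b) (d.ξ c)
  have t2 := m.symm (m.L b a) (d.ξ c)
  have t3 := m.symm (m.L b c) (d.ξ a)
  have t4 := m.symm (m.L c b) (d.ξ a)
  have t5 := m.symm (m.L c a) (d.ξ b)
  have t6 := m.symm (m.L a c) (d.ξ b)
  linarith

/-- Auxiliary half of `invariance`. -/
theorem half (a b : B) : m.form (d.ξ (d.D a)) b - m.form (d.ξ a) (d.ξ b)
    + m.form (d.ξ a) (d.D b) = d.μ * m.form (d.ξ a) b - m.form d.b₀ (m.L a b) := by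
  have h : d.D (d.ξ a) - d.ξ (d.D a) = d.ξ (d.ξ a) - d.μ • d.ξ a - m.L a d.b₀ :=
    LinearMap.congr_fun d.commutator a
  have h1 : m.form (d.D (d.ξ a) - d.ξ (d.ξ a)) b = -m.form (d.ξ a) (d.D b - d.ξ b) :=
    d.skew (d.ξ a) b
  have h2 := m.L_skew a d.b₀ b
  have h3 : m.form (d.D (d.ξ a) - d.ξ (d.D a)) b
      = m.form (d.ξ (d.ξ a) - d.μ • d.ξ a - m.L a d.b₀) b := by rw [h]
  simp only [map_sub, LinearMap.sub_apply, map_smul, LinearMap.smul_apply, smul_eq_mul] at h1 h3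
  linarith

theorem invariance (a b : B) :
    (m.form (d.ξ (d.D a)) b - m.form (d.D a) (d.ξ b))
      + (m.form (d.ξ a) (d.D b) - m.form a (d.ξ (d.D b)))
      = d.μ * (m.form (d.ξ a) b - m.form a (d.ξ b)) - m.form d.b₀ ⁅a, b⁆ := by
  have h1 := half d a b
  have h2 := half d b a
  rw [← m.L_sub_L a b, map_sub, m.symm (d.D a), m.symm a (d.ξ (d.D b)), m.symm a (d.ξ b)]
  rw [m.symm (d.ξ b) (d.ξ a)] at h2
  linarith

noncomputable instance : LieRing (DoubleExtension d) where
  add_lie p q r := by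
    apply ext'
    · simp only [lie_fst, add_fst, add_mid, add_snd, map_add, LinearMap.add_apply]; ring
    · simp only [lie_mid, add_mid, add_snd, map_add, add_smul, smul_add, add_lie]; abel
    · simp
  lie_add p q r := by
    apply ext'
    · simp only [lie_fst, add_fst, add_mid, add_snd, map_add]; ring
    · simp only [lie_mid, add_mid, add_snd, map_add, add_smul, smul_add, lie_add]; abel
    · simp
  lie_self p := by
    apply ext'
    · simp [m.symm p.2.1]
    · simp
    · simp
  leibniz_lie p q r := by
    apply ext'
    · have c := closed d p.2.1 q.2.1 r.2.1
      have i1 := invariance d p.2.1 q.2.1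
      have i2 := invariance d q.2.1 r.2.1
      have i3 := invariance d p.2.1 r.2.1
      have e1 : m.form (d.ξ p.2.1) ⁅q.2.1, r.2.1⁆ = m.form ⁅q.2.1, r.2.1⁆ (d.ξ p.2.1) :=
        m.symm _ _
      have e2 : m.form p.2.1 (d.ξ ⁅q.2.1, r.2.1⁆) = m.form (d.ξ ⁅q.2.1, r.2.1⁆) p.2.1 :=
        m.symm _ _
      have e3 : m.form (d.ξ q.2.1) ⁅p.2.1, r.2.1⁆ = -m.form ⁅r.2.1, p.2.1⁆ (d.ξ q.2.1) := by
        rw [m.symm, ← lie_skew, map_neg, LinearMap.neg_apply]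
      have e4 : m.form q.2.1 (d.ξ ⁅p.2.1, r.2.1⁆) = -m.form (d.ξ ⁅r.2.1, p.2.1⁆) q.2.1 := by
        rw [m.symm, ← lie_skew, map_neg, map_neg, LinearMap.neg_apply]
      simp only [lie_fst, lie_mid, lie_snd, add_fst, map_add, map_sub, map_smul,
        LinearMap.add_apply, LinearMap.sub_apply, LinearMap.smul_apply, smul_eq_mul]
      rw [e1, e2, e3, e4]
      have f1 := m.symm q.2.1 (d.ξ (d.D p.2.1))
      have f2 := m.symm (d.D p.2.1) (d.ξ q.2.1)
      linear_combination (-1 : ℝ) * c - r.2.2 * i1 - p.2.2 * i2 + q.2.2 * i3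
        - r.2.2 * f1 - r.2.2 * f2
    · simp only [lie_mid, lie_snd, add_mid, lie_add, add_lie, lie_sub, sub_lie, lie_smul, smul_lie,
        map_add, map_sub, map_smul, smul_add, smul_sub, derivation, zero_smul, sub_zero, zero_sub,
        leibniz_lie p.2.1 q.2.1 r.2.1]
      rw [← lie_skew q.2.1 (d.D p.2.1)]
      module
    · simp

noncomputable instance : LieAlgebra ℝ (DoubleExtension d) where
  lie_smul c p q := by
    apply ext'
    · simp only [lie_fst, smul_fst, smul_mid, smul_snd, map_smul,
        smul_eq_mul]; ring
    · simp only [lie_mid, smul_mid, smul_snd, map_smul, lie_smul]; module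
    · simp

/-- The inner product extending that of `B` with `⟨e,e⟩ = ⟨ē,ē⟩ = 0`, `⟨e,ē⟩ = 1` and
`span {e, ē}` orthogonal to `B`. -/
def metric : Metric (DoubleExtension d) where
  form := LinearMap.mk₂ ℝ (fun p q => m.form p.2.1 q.2.1 + p.1 * q.2.2 + p.2.2 * q.1)
    (fun p q r => by simp only [add_fst, add_mid, add_snd, map_add, LinearMap.add_apply]; ring)
    (fun c p q => by
      simp only [smul_fst, smul_mid, smul_snd, map_smul, LinearMap.smul_apply, smul_eq_mul]; ring)
    (fun p q r => by simp only [add_fst, add_mid, add_snd, map_add]; ring)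
    (fun c p q => by simp only [smul_fst, smul_mid, smul_snd, map_smul, smul_eq_mul]; ring)
  symm p q := by simp only [LinearMap.mk₂_apply, m.symm p.2.1]; ring
  nondegenerate := by
    constructor
    · intro p hp
      apply ext'
      · have h : m.form p.2.1 0 + p.1 * 1 + p.2.2 * 0 = 0 := hp ((0, 0, 1) : ℝ × B × ℝ)
        simpa using h
      · apply m.nondegenerate.1
        intro b
        have h : m.form p.2.1 b + p.1 * 0 + p.2.2 * 0 = 0 := hp ((0, b, 0) : ℝ × B × ℝ)
        simpa using h
      · have h : m.form p.2.1 0 + p.1 * 0 + p.2.2 * 1 = 0 := hp ((1, 0, 0) : ℝ × B × ℝ)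
        simpa using h
    · intro p hp
      apply ext'
      · have h : m.form 0 p.2.1 + 0 * p.2.2 + 1 * p.1 = 0 := hp ((0, 0, 1) : ℝ × B × ℝ)
        simpa using h
      · apply m.nondegenerate.2
        intro b
        have h : m.form b p.2.1 + 0 * p.2.2 + 0 * p.1 = 0 := hp ((0, b, 0) : ℝ × B × ℝ)
        simpa using h
      · have h : m.form 0 p.2.1 + 1 * p.2.2 + 0 * p.1 = 0 := hp ((1, 0, 0) : ℝ × B × ℝ)
        simpa using h

end DoubleExtension
end DoubleExtension
end FlatLie

/-! Write h for the modular vector. Flatness says R_{u.v} = R_v R_u + [L_u, R_v], and tr R_u =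
-⟨h,u⟩, so tr(R_u R_v) = ⟨u.h, v⟩. Hence R_h is symmetric, h.h = 0, and R_h² = [R_h, L_h] forces R_h
to be nilpotent (`isNilpotent_of_commutator_eq_sq`); so ⟨h,h⟩ = -tr R_h = 0.

Complete h = e to a hyperbolic pair (e, f). The form is positive definite on {e, f}^⊥, a model of
h^⊥/ℝh, so a symmetric or skew compression with traceless square vanishes there. This gives u.h =
α⟨h,u⟩h (`IsFlat.L_apply_modularVector`): ℝh is a left ideal and h^⊥ a two-sided one.

The hard point is L_h = 0. The algebra h^⊥ acts on the Euclidean space h^⊥/ℝh by infinitesimal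
affine isometries, transitively at the origin, with isotropy ℝh. Averaging over an orthonormal basis
of the linear parts (`IsRiemannian.cocycle_orthogonal`) shows that [h, h^⊥] has zero linear part. If
the compression A of L_h were nonzero, u ↦ tr(A L_u)/tr(A²) would be represented by a vector
orthogonal to [h^⊥, g], and shifting it along h would give a null f with ⟨h,f⟩ = 1. The compression
of R_f is then symmetric with traceless square, so tr R_f = 0, against tr R_f = -⟨h,f⟩ = -1.

Once L_h = 0, h^⊥/ℝh inherits a flat Riemannian structure, L_f and R_f supply the quadruple, and the
flatness equations involving f become admissibility. Finally tr D + μ = tr ad_f = ⟨h,f⟩ = 1. -/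

namespace FlatLie

/-! ### A nilpotency criterion -/

/-- If `[B, A] = B²` on a finite-dimensional real vector space then `B` is nilpotent. -/
theorem isNilpotent_of_commutator_eq_sq {V : Type u} [AddCommGroup V] [Module ℝ V]
    [FiniteDimensional ℝ V] {A B : Module.End ℝ V} (h : B * A - A * B = B * B) :
    IsNilpotent B := by
  have hpow : ∀ n : ℕ, A * B ^ n = B ^ n * (A - (n : ℝ) • B) := by
    intro n
    induction n with
    | zero => simp
    | succ n ih =>
      have hAB : A * B = B * A - B * B := by rw [← h]; abel
      rw [pow_succ, ← mul_assoc, ih]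
      simp only [mul_assoc, sub_mul, mul_sub, hAB, smul_mul_assoc, mul_smul_comm]
      push_cast
      module
  -- On the stable range W of the powers, B is invertible; by `hpow`, W is also A-stable.
  obtain ⟨n, hn⟩ := Filter.eventually_atTop.1 B.eventually_iInf_range_pow_eq
  have hrange : LinearMap.range (B ^ n) = LinearMap.range (B ^ (n + 1)) :=
    (hn n le_rfl).symm.trans (hn (n + 1) (Nat.le_succ n))
  set W := LinearMap.range (B ^ n) with hW
  have hBW : ∀ x ∈ W, B x ∈ W := by
    rintro _ ⟨y, rfl⟩
    exact ⟨B y, by rw [← Module.End.mul_apply, ← pow_succ, pow_succ', Module.End.mul_apply]⟩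
  have hAW : ∀ x ∈ W, A x ∈ W := by
    rintro _ ⟨y, rfl⟩
    exact ⟨(A - (n : ℝ) • B) y, by rw [← Module.End.mul_apply, ← hpow, Module.End.mul_apply]⟩
  let A' : Module.End ℝ W := A.restrict hAW
  let B' : Module.End ℝ W := B.restrict hBW
  have hcomm : B' * A' - A' * B' = B' * B' := by
    ext x
    exact LinearMap.congr_fun h (x : V)
  have hsurj : Function.Surjective B' := by
    rintro ⟨x, hx⟩
    rw [hrange] at hx
    obtain ⟨y, rfl⟩ := hx
    refine ⟨⟨(B ^ n) y, y, rfl⟩, Subtype.ext ?_⟩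
    change B ((B ^ n) y) = _
    exact LinearMap.congr_fun (pow_succ' B n).symm y
  have hunit : IsUnit B' :=
    (Module.End.isUnit_iff B').2 ⟨LinearMap.injective_iff_surjective.2 hsurj, hsurj⟩
  obtain ⟨b, hb⟩ := hunit
  rw [← hb] at hcomm
  -- Conjugating the relation by the inverse writes 1 as a commutator, whose trace is both 0 and dim
  -- W.
  have h1 : A' * (↑b⁻¹ : Module.End ℝ W) - ↑b⁻¹ * A' = 1 := by
    calc A' * (↑b⁻¹ : Module.End ℝ W) - ↑b⁻¹ * A'
        = ↑b⁻¹ * (↑b * A' - A' * ↑b) * ↑b⁻¹ := by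
          simp only [mul_sub, sub_mul, mul_assoc, Units.mul_inv, mul_one,
            Units.inv_mul_cancel_left]
      _ = 1 := by rw [hcomm]; simp
  have h2 := congrArg (LinearMap.trace ℝ W) h1
  rw [map_sub, LinearMap.trace_mul_comm, sub_self, LinearMap.trace_one] at h2
  have h3 : Module.finrank ℝ W = 0 := by
    have : (Module.finrank ℝ W : ℝ) = 0 := by linarith
    exact_mod_cast this
  exact ⟨n, LinearMap.range_eq_bot.1 (Submodule.finrank_eq_zero.1 h3)⟩

/-! ### Symmetric and skew endomorphisms; Euclidean spaces -/

namespace Metric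

variable {V : Type u} [AddCommGroup V] [Module ℝ V] (m : Metric V)

theorem ext_form {x y : V} (h : ∀ w, m.form x w = m.form y w) : x = y :=
  sub_eq_zero.1 (m.nondegenerate.1 _ fun w => by simp [h w])

variable {m}

theorem IsSkew.apply_self {f : Module.End ℝ V} (hf : m.IsSkew f) (x : V) :
    m.form (f x) x = 0 := by
  have h1 := hf x x
  rw [m.symm x] at h1
  linarith

/-- The form identifies f with minus its transpose, which has the opposite trace. -/
theorem IsSkew.trace_eq_zero [FiniteDimensional ℝ V] {f : Module.End ℝ V} (hf : m.IsSkew f) :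
    LinearMap.trace ℝ V f = 0 := by
  have h : (m.form.toDual m.nondegenerate).conj f = Module.Dual.transpose (-f) := by
    ext φ x
    obtain ⟨y, rfl⟩ := (m.form.toDual m.nondegenerate).surjective φ
    simpa [LinearEquiv.conj_apply, LinearMap.BilinForm.toDual_def, Module.Dual.transpose_apply]
      using hf y x
  have h1 := LinearMap.trace_conj' f (m.form.toDual m.nondegenerate)
  rw [h, LinearMap.trace_transpose', map_neg] at h1
  linarith

/-- A positive definite symmetric bilinear form is an inner product. -/
def ofPosDef (B : LinearMap.BilinForm ℝ V) (hs : ∀ x y, B x y = B y x)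
    (hp : ∀ x, x ≠ 0 → 0 < B x x) : Metric V where
  form := B
  symm := hs
  nondegenerate := by
    constructor
    · intro x hx
      by_contra h
      exact (hp x h).ne' (hx x)
    · intro x hx
      by_contra h
      exact (hp x h).ne' (hx x)

theorem IsRiemannian.nonneg (hm : m.IsRiemannian) (x : V) : 0 ≤ m.form x x := by
  rcases eq_or_ne x 0 with rfl | h
  · simp
  · exact (hm x h).le

theorem IsRiemannian.eq_zero (hm : m.IsRiemannian) {x : V} (hx : m.form x x = 0) : x = 0 := by
  by_contra h
  exact (hm x h).ne' hx

theorem repr_eq_form {ι : Type*} [Fintype ι] [DecidableEq ι] (b : Module.Basis ι ℝ V)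
    (hb : ∀ i j, m.form (b i) (b j) = if i = j then 1 else 0) (x : V) (i : ι) :
    b.repr x i = m.form x (b i) := by
  conv_rhs => rw [← b.sum_repr x]
  rw [map_sum, LinearMap.sum_apply]
  simp [hb]

theorem sum_form_smul {ι : Type*} [Fintype ι] [DecidableEq ι] (b : Module.Basis ι ℝ V)
    (hb : ∀ i j, m.form (b i) (b j) = if i = j then 1 else 0) (x : V) :
    ∑ i, m.form x (b i) • b i = x := by
  simp only [← repr_eq_form b hb, b.sum_repr]

theorem trace_eq_sum_form {ι : Type*} [Fintype ι] [DecidableEq ι] (b : Module.Basis ι ℝ V)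
    (hb : ∀ i j, m.form (b i) (b j) = if i = j then 1 else 0) (f : Module.End ℝ V) :
    LinearMap.trace ℝ V f = ∑ i, m.form (f (b i)) (b i) := by
  rw [LinearMap.trace_eq_matrix_trace ℝ b, Matrix.trace]
  refine Finset.sum_congr rfl fun i _ => ?_
  rw [Matrix.diag_apply, LinearMap.toMatrix_apply, repr_eq_form b hb]

variable [FiniteDimensional ℝ V]

theorem IsRiemannian.exists_orthonormal_basis (hm : m.IsRiemannian) :
    ∃ b : Module.Basis (Fin (Module.finrank ℝ V)) ℝ V,
      ∀ i j, m.form (b i) (b j) = if i = j then 1 else 0 := by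
  obtain ⟨v, hv⟩ := LinearMap.BilinForm.exists_orthogonal_basis (B := m.form) ⟨m.symm⟩
  have hpos : ∀ i, 0 < m.form (v i) (v i) := fun i => hm _ (v.ne_zero i)
  have hsqrt : ∀ i, 0 < Real.sqrt (m.form (v i) (v i)) := fun i => Real.sqrt_pos.2 (hpos i)
  refine ⟨v.isUnitSMul (w := fun i => (Real.sqrt (m.form (v i) (v i)))⁻¹)
    (fun i => (inv_pos.2 (hsqrt i)).ne'.isUnit), fun i j => ?_⟩
  rw [Module.Basis.isUnitSMul_apply, Module.Basis.isUnitSMul_apply]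
  simp only [map_smul, LinearMap.smul_apply, smul_eq_mul]
  split_ifs with h
  · subst h
    have h1 := Real.mul_self_sqrt (hpos i).le
    have h2 := (hsqrt i).ne'
    field_simp
    rw [← h1]; ring_nf
    rw [Real.sqrt_sq (hsqrt i).le]
  · have : m.form (v i) (v j) = 0 := hv h
    simp [this]

/-- A symmetric endomorphism of a Euclidean space whose square is traceless vanishes. -/
theorem IsRiemannian.symmetric_eq_zero (hm : m.IsRiemannian) {f : Module.End ℝ V}
    (hf : ∀ x y, m.form (f x) y = m.form x (f y)) (h : LinearMap.trace ℝ V (f * f) = 0) :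
    f = 0 := by
  obtain ⟨b, hb⟩ := hm.exists_orthonormal_basis
  rw [trace_eq_sum_form b hb, Finset.sum_eq_zero_iff_of_nonneg] at h
  · refine b.ext fun i => hm.eq_zero ?_
    rw [← h i (Finset.mem_univ i), Module.End.mul_apply, hf (f (b i))]
  · intro i _
    rw [Module.End.mul_apply, hf]
    exact hm.nonneg _

theorem IsRiemannian.trace_skew_sq_nonpos (hm : m.IsRiemannian) {f : Module.End ℝ V}
    (hf : m.IsSkew f) : LinearMap.trace ℝ V (f * f) ≤ 0 := by
  obtain ⟨b, hb⟩ := hm.exists_orthonormal_basis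
  rw [trace_eq_sum_form b hb]
  refine Finset.sum_nonpos fun i _ => ?_
  rw [Module.End.mul_apply, hf, neg_nonpos]
  exact hm.nonneg _

/-- A skew-symmetric endomorphism of a Euclidean space whose square is traceless vanishes. -/
theorem IsRiemannian.skew_eq_zero (hm : m.IsRiemannian) {f : Module.End ℝ V}
    (hf : m.IsSkew f) (h : LinearMap.trace ℝ V (f * f) = 0) : f = 0 := by
  obtain ⟨b, hb⟩ := hm.exists_orthonormal_basis
  rw [trace_eq_sum_form b hb, Finset.sum_eq_zero_iff_of_nonpos] at h
  · refine b.ext fun i => hm.eq_zero ?_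
    have h1 := h i (Finset.mem_univ i)
    rw [Module.End.mul_apply, hf, neg_eq_zero] at h1
    exact h1
  · intro i _
    rw [Module.End.mul_apply, hf, neg_nonpos]
    exact hm.nonneg _

/-- Orthogonal projection onto a subspace of a Euclidean space. -/
theorem IsRiemannian.exists_sub_orthogonal (hm : m.IsRiemannian) (W : Submodule ℝ V) (x : V) :
    ∃ y ∈ W, ∀ w ∈ W, m.form (x - y) w = 0 := by
  let mW : Metric W := ofPosDef (m.form.restrict W) (fun a b => m.symm a b)
    (fun a ha => hm a (by simpa using ha))
  obtain ⟨y, hy⟩ := (mW.form.toDual mW.nondegenerate).surjective (m.form x ∘ₗ W.subtype)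
  refine ⟨y, y.2, fun w hw => ?_⟩
  have h1 : m.form y w = m.form x w := LinearMap.congr_fun hy ⟨w, hw⟩
  simp [h1]

/-- The square of a skew-symmetric endomorphism of a Euclidean space has the same range. -/
theorem IsRiemannian.exists_skew_skew_eq (hm : m.IsRiemannian) {f : Module.End ℝ V}
    (hf : m.IsSkew f) (x : V) : ∃ y, f (f y) = f x := by
  obtain ⟨_, ⟨y, rfl⟩, hy⟩ := hm.exists_sub_orthogonal (LinearMap.range f) x
  refine ⟨y, (sub_eq_zero.1 (hm.eq_zero ?_)).symm⟩
  rw [← map_sub, hf, hy _ ⟨_, rfl⟩, neg_zero]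

end Metric
end FlatLie

/-! ### Infinitesimal affine isometries of a Euclidean space -/

namespace FlatLie

theorem sum_skew_mul_symm_eq_zero {ι : Type*} [Fintype ι] {a s : ι → ι → ℝ}
    (ha : ∀ i j, a i j = -a j i) (hs : ∀ i j, s i j = s j i) :
    ∑ i, ∑ j, a i j * s i j = 0 := by
  have h : ∑ i, ∑ j, a i j * s i j = -∑ i, ∑ j, a i j * s i j := by
    conv_lhs => rw [Finset.sum_comm]
    simp only [← Finset.sum_neg_distrib]
    refine Finset.sum_congr rfl fun i _ => Finset.sum_congr rfl fun j _ => ?_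
    rw [ha j i, hs j i]; ring
  linarith

namespace Metric

variable {E : Type*} [AddCommGroup E] [Module ℝ E] [FiniteDimensional ℝ E] {m : Metric E}

/-- The inner product `-tr (X Y)` on a space of skew-symmetric endomorphisms of a Euclidean
space. -/
noncomputable def IsRiemannian.traceMetric (hm : m.IsRiemannian)
    (K : Submodule ℝ (Module.End ℝ E)) (hK : ∀ X ∈ K, m.IsSkew X) : Metric K :=
  ofPosDef
    ((-(LinearMap.mul ℝ (Module.End ℝ E)).compr₂ (LinearMap.trace ℝ E)).domRestrict₁₂ K K)
    (fun X Y => congrArg Neg.neg (LinearMap.trace_mul_comm ℝ (X : Module.End ℝ E) Y))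
    (fun X hX => neg_pos.2 <| (hm.trace_skew_sq_nonpos (hK X X.2)).lt_of_ne
      fun h => hX (Subtype.ext (hm.skew_eq_zero (hK X X.2) h)))

theorem IsRiemannian.traceMetric_form (hm : m.IsRiemannian)
    (K : Submodule ℝ (Module.End ℝ E)) (hK : ∀ X ∈ K, m.IsSkew X) (X Y : K) :
    (hm.traceMetric K hK).form X Y
      = -LinearMap.trace ℝ E ((X : Module.End ℝ E) * (Y : Module.End ℝ E)) := rfl

theorem IsRiemannian.traceMetric_isRiemannian (hm : m.IsRiemannian)
    (K : Submodule ℝ (Module.End ℝ E)) (hK : ∀ X ∈ K, m.IsSkew X) :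
    (hm.traceMetric K hK).IsRiemannian := fun X hX =>
  neg_pos.2 <| (hm.trace_skew_sq_nonpos (hK X X.2)).lt_of_ne
    fun h => hX (Subtype.ext (hm.skew_eq_zero (hK X X.2) h))

variable {I : Type*} [LieRing I] [LieAlgebra ℝ I]

/-- If a Lie algebra acts on a Euclidean space by infinitesimal isometries `x ↦ ρ u x + π u`,
transitively at the origin, then `ρ` vanishes on the orthogonal of the space `π (ker ρ)` of
translations in its image. -/
theorem IsRiemannian.cocycle_orthogonal (hm : m.IsRiemannian) (ρ : I →ₗ[ℝ] Module.End ℝ E)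
    (hρ : ∀ u v, ρ ⁅u, v⁆ = ⁅ρ u, ρ v⁆) (hskew : ∀ u, m.IsSkew (ρ u)) (π : I →ₗ[ℝ] E)
    (hπ : Function.Surjective π) (hc : ∀ u v, π ⁅u, v⁆ = ρ u (π v) - ρ v (π u))
    {w : E} (hw : ∀ n, ρ n = 0 → m.form w (π n) = 0) (u : I) : ρ u w = 0 := by
  set K := LinearMap.range ρ
  have hK : ∀ X ∈ K, m.IsSkew X := by rintro _ ⟨u, rfl⟩; exact hskew u
  obtain ⟨b, hb⟩ := (hm.traceMetric_isRiemannian K hK).exists_orthonormal_basis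
  -- Since ker ρ is an ideal, π (ker ρ) is ρ-stable, and so is its orthogonal.
  have hstable : ∀ w, (∀ n, ρ n = 0 → m.form w (π n) = 0) → ∀ u, ∀ n, ρ n = 0 →
      m.form (ρ u w) (π n) = 0 := by
    intro w hw u n hn
    have h1 : π ⁅u, n⁆ = ρ u (π n) := by simp [hc, hn]
    rw [hskew, ← h1, hw, neg_zero]
    rw [hρ, hn, Ring.lie_def, mul_zero, zero_mul, sub_zero]
  -- Lifts of the orthonormal basis are corrected by elements of ker ρ so that their translation
  -- parts are orthogonal to π (ker ρ).
  have hx : ∀ i, ∃ x, ρ x = b i ∧ ∀ n, ρ n = 0 → m.form (π x) (π n) = 0 := by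
    intro i
    obtain ⟨x, hx⟩ := (b i).2
    obtain ⟨_, ⟨n, hn, rfl⟩, ho⟩ :=
      hm.exists_sub_orthogonal ((LinearMap.ker ρ).map π) (π x)
    refine ⟨x - n, by rw [map_sub, hx, LinearMap.mem_ker.1 hn, sub_zero], fun k hk => ?_⟩
    rw [map_sub]
    exact ho _ ⟨k, hk, rfl⟩
  choose x hxρ hxW using hx
  let a : I → _ → ℝ := fun v j => -LinearMap.trace ℝ E (ρ v * ρ (x j))
  have hexp : ∀ v, ρ v = ∑ j, a v j • ρ (x j) := by
    intro v
    have h1 := congrArg Subtype.val (sum_form_smul b hb ⟨ρ v, v, rfl⟩)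
    rw [AddSubmonoidClass.coe_finsetSum] at h1
    simp only [Submodule.coe_smul, traceMetric_form, ← hxρ] at h1
    exact h1.symm
  have hexpπ : ∀ v w, (∀ n, ρ n = 0 → m.form w (π n) = 0) →
      m.form (π v) w = ∑ j, a v j * m.form (π (x j)) w := by
    intro v w hw
    have h1 := hw (v - ∑ j, a v j • x j) (by
      rw [map_sub, map_sum]; simp only [map_smul]; rw [← hexp, sub_self])
    rw [m.symm, map_sub, map_sum, LinearMap.map_sub₂, sub_eq_zero] at h1
    simpa using h1
  -- Invariance of the trace form: bracketing with v is skew in an orthonormal basis.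
  have hskewa : ∀ v i j, a ⁅x i, v⁆ j = -a ⁅x j, v⁆ i := by
    intro v i j
    have h1 : LinearMap.trace ℝ E (ρ (x i) * ρ v * ρ (x j))
        = LinearMap.trace ℝ E (ρ v * ρ (x j) * ρ (x i)) := by
      rw [mul_assoc, LinearMap.trace_mul_comm]
    have h2 : LinearMap.trace ℝ E (ρ (x j) * ρ v * ρ (x i))
        = LinearMap.trace ℝ E (ρ v * ρ (x i) * ρ (x j)) := by
      rw [mul_assoc, LinearMap.trace_mul_comm]
    simp only [a, hρ, Ring.lie_def, sub_mul, map_sub]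
    linarith
  -- The Casimir-like vector Σ ρ(x i) π(x i) pairs to zero with w: choosing v over w, the pairing is
  -- a skew array contracted with the Gram matrix of the π(x i).
  have hcW : ∀ w, (∀ n, ρ n = 0 → m.form w (π n) = 0) →
      m.form (∑ i, ρ (x i) (π (x i))) w = 0 := by
    intro w hw
    obtain ⟨v, hv⟩ := hπ w
    rw [map_sum, LinearMap.sum_apply]
    have h1 : ∀ i, m.form (ρ (x i) (π (x i))) w
        = -∑ j, a ⁅x i, v⁆ j * m.form (π (x j)) (π (x i)) := by
      intro i
      have h2 := (hskew v).apply_self (π (x i))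
      rw [← hexpπ _ _ (hxW i), hskew, hc, hv, map_sub, LinearMap.sub_apply, h2, sub_zero,
        m.symm (π (x i))]
    rw [Finset.sum_congr rfl fun i _ => h1 i, Finset.sum_neg_distrib,
      sum_skew_mul_symm_eq_zero (hskewa v) (fun i j => m.symm _ _), neg_zero]
  -- Applying ρ v to that vector and pairing with w again gives zero; its expansion is -Σ |ρ(x i)
  -- w|² plus another skew-symmetric contraction.
  have hterm : ∀ v, π v = w → ∀ i, m.form (ρ v (ρ (x i) (π (x i)))) w
      = -m.form (ρ (x i) w) (ρ (x i) w)
        + ∑ j, a ⁅x i, v⁆ j * (m.form (π (x j)) (ρ (x i) w) + m.form (π (x i)) (ρ (x j) w)) := by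
    intro v hv i
    have h1 : ρ v (ρ (x i) (π (x i)))
        = ρ (x i) (ρ v (π (x i))) - ρ ⁅x i, v⁆ (π (x i)) := by
      rw [hρ, Ring.lie_def, LinearMap.sub_apply, Module.End.mul_apply, Module.End.mul_apply]
      abel
    have h2 : ρ v (π (x i)) = ρ (x i) w - π ⁅x i, v⁆ := by rw [hc, hv]; abel
    have h3 : m.form (π (x i)) (ρ ⁅x i, v⁆ w)
        = ∑ j, a ⁅x i, v⁆ j * m.form (π (x i)) (ρ (x j) w) := by
      conv_lhs => rw [hexp]
      simp only [LinearMap.sum_apply, map_sum, LinearMap.smul_apply, map_smul, smul_eq_mul]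
    rw [h1, map_sub, LinearMap.sub_apply, hskew, hskew ⁅x i, v⁆, h2, map_sub,
      LinearMap.sub_apply, hexpπ _ _ (hstable w hw (x i)), h3]
    simp only [mul_add, Finset.sum_add_distrib]
    ring
  have hsum : ∑ i, m.form (ρ (x i) w) (ρ (x i) w) = 0 := by
    obtain ⟨v, hv⟩ := hπ w
    have h1 : m.form (ρ v (∑ i, ρ (x i) (π (x i)))) w = 0 := by
      rw [hskew, hcW _ (hstable w hw v), neg_zero]
    rw [map_sum, map_sum, LinearMap.sum_apply, Finset.sum_congr rfl fun i _ => hterm v hv i,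
      Finset.sum_add_distrib, sum_skew_mul_symm_eq_zero (hskewa v) (fun i j => add_comm _ _),
      Finset.sum_neg_distrib] at h1
    linarith
  rw [Finset.sum_eq_zero_iff_of_nonneg fun i _ => hm.nonneg _] at hsum
  have hzero : ∀ i, ρ (x i) w = 0 := fun i => hm.eq_zero (hsum i (Finset.mem_univ i))
  rw [hexp u]
  simp [hzero]

/-- In the situation of `IsRiemannian.cocycle_orthogonal`, a spanning vector of the isotropy
algebra of the origin is central modulo the kernel of `ρ`. -/
theorem IsRiemannian.cocycle_lie_eq_zero (hm : m.IsRiemannian) (ρ : I →ₗ[ℝ] Module.End ℝ E)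
    (hρ : ∀ u v, ρ ⁅u, v⁆ = ⁅ρ u, ρ v⁆) (hskew : ∀ u, m.IsSkew (ρ u)) (π : I →ₗ[ℝ] E)
    (hπ : Function.Surjective π) (hc : ∀ u v, π ⁅u, v⁆ = ρ u (π v) - ρ v (π u))
    {h : I} (hh : π h = 0) (hker : ∀ u, π u = 0 → ∃ t : ℝ, u = t • h) (u : I) :
    ρ ⁅h, u⁆ = 0 := by
  -- The part d of π ⁅h, u⁆ = ρ h (π u) orthogonal to π (ker ρ) is killed by ρ h, so it is
  -- orthogonal to ρ h (π u), hence to itself.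
  have hV : ∃ n, ρ n = 0 ∧ π n = π ⁅h, u⁆ := by
    obtain ⟨_, ⟨n, hn, rfl⟩, ho⟩ :=
      hm.exists_sub_orthogonal ((LinearMap.ker ρ).map π) (π ⁅h, u⁆)
    refine ⟨n, hn, (sub_eq_zero.1 (hm.eq_zero ?_)).symm⟩
    have h1 := hm.cocycle_orthogonal ρ hρ hskew π hπ hc
      (fun k hk => ho (π k) ⟨k, hk, rfl⟩) h
    have h2 : m.form (π ⁅h, u⁆ - π n) (π ⁅h, u⁆) = 0 := by
      rw [hc, hh, map_zero, sub_zero, m.symm, hskew, ← neg_eq_zero, neg_neg]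
      rw [hc, hh, map_zero, sub_zero] at h1
      rw [h1, map_zero]
    rw [map_sub, h2, ho _ ⟨n, hn, rfl⟩, sub_zero]
  obtain ⟨n, hn, hnπ⟩ := hV
  obtain ⟨t, ht⟩ := hker (⁅h, u⁆ - n) (by rw [map_sub, hnπ, sub_self])
  have h1 : ρ ⁅h, u⁆ = t • ρ h := by
    rw [← map_smul, ← ht, map_sub, hn, sub_zero]
  -- With [ρ h, ρ u] = t ρ h, the trace of [ρ h, ρ u] ρ h vanishes by cyclicity, so t = 0 or the
  -- skew map ρ h is zero.
  have h2 : t * LinearMap.trace ℝ E (ρ h * ρ h) = 0 := by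
    rw [← smul_eq_mul, ← map_smul, ← smul_mul_assoc, ← h1, hρ, Ring.lie_def, sub_mul, map_sub,
      mul_assoc, LinearMap.trace_mul_comm, sub_self]
  rcases mul_eq_zero.1 h2 with h3 | h3
  · rw [h1, h3, zero_smul]
  · rw [h1, hm.skew_eq_zero (hskew h) h3, smul_zero]

end Metric
end FlatLie

/-! ### Hyperbolic pairs and compression to their orthogonal -/

namespace FlatLie

namespace Metric

section NullPair

variable {V : Type u} [AddCommGroup V] [Module ℝ V]

/-- A hyperbolic pair: null vectors `e`, `f` with `⟨e, f⟩ = 1`. -/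
structure NullPair (m : Metric V) where
  e : V
  f : V
  ee : m.form e e = 0
  ff : m.form f f = 0
  ef : m.form e f = 1

/-- The hyperbolic pair obtained from a null vector `e` and a vector `y` with `⟨e, y⟩ = 1` by
shifting `y` along `e`. -/
noncomputable def NullPair.mk' (m : Metric V) (e y : V) (he : m.form e e = 0) (hy : m.form e y = 1) :
    NullPair m where
  e := e
  f := y - (m.form y y / 2) • e
  ee := he
  ff := by
    have h1 : m.form y e = 1 := by rw [m.symm, hy]
    simp only [map_sub, map_smul, LinearMap.sub_apply, LinearMap.smul_apply, smul_eq_mul, he, hy,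
      h1]
    ring
  ef := by simp [he, hy]

theorem exists_form_eq_one (m : Metric V) {e : V} (he : e ≠ 0) : ∃ y, m.form e y = 1 := by
  by_contra! h
  refine he (m.nondegenerate.1 _ fun y => ?_)
  by_contra hy
  exact h ((m.form e y)⁻¹ • y) (by simp [hy])

namespace NullPair

variable {m : Metric V} (p : NullPair m)

theorem fe : m.form p.f p.e = 1 := by rw [m.symm, p.ef]

/-- The orthogonal of a hyperbolic pair. -/
def perp : Submodule ℝ V := LinearMap.ker (m.form p.e) ⊓ LinearMap.ker (m.form p.f)

theorem mem_perp {x : V} : x ∈ p.perp ↔ m.form p.e x = 0 ∧ m.form p.f x = 0 := by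
  simp [perp]

theorem e_perp (b : p.perp) : m.form p.e b = 0 := (p.mem_perp.1 b.2).1
theorem f_perp (b : p.perp) : m.form p.f b = 0 := (p.mem_perp.1 b.2).2
theorem perp_e (b : p.perp) : m.form b p.e = 0 := by rw [m.symm, p.e_perp]
theorem perp_f (b : p.perp) : m.form b p.f = 0 := by rw [m.symm, p.f_perp]

/-- The orthogonal projection onto the orthogonal of a hyperbolic pair. -/
def proj : V →ₗ[ℝ] p.perp :=
  LinearMap.codRestrict p.perp
    (LinearMap.id - (m.form p.f).smulRight p.e - (m.form p.e).smulRight p.f)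
    (fun x => by rw [mem_perp]; simp [p.ee, p.ff, p.ef, p.fe])

theorem coe_proj (x : V) :
    (p.proj x : V) = x - m.form p.f x • p.e - m.form p.e x • p.f := rfl

theorem decomp (x : V) : x = m.form p.f x • p.e + p.proj x + m.form p.e x • p.f := by
  rw [coe_proj]; abel

@[simp] theorem proj_coe (b : p.perp) : p.proj b = b := by
  apply Subtype.ext; simp [coe_proj, e_perp, f_perp]

@[simp] theorem proj_f : p.proj p.f = 0 := by
  apply Subtype.ext; simp [coe_proj, p.ff, p.ef]

@[simp] theorem proj_e : p.proj p.e = 0 := by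
  apply Subtype.ext; simp [coe_proj, p.ee, p.fe]

theorem form_proj_left (x : V) (b : p.perp) : m.form (p.proj x) b = m.form x b := by
  simp [coe_proj, e_perp, f_perp]

theorem form_proj_right (b : p.perp) (x : V) : m.form b (p.proj x) = m.form b x := by
  rw [m.symm, form_proj_left, m.symm]

theorem form_eq (x y : V) : m.form x y = m.form (p.proj x) (p.proj y)
    + m.form p.f x * m.form p.e y + m.form p.e x * m.form p.f y := by
  have h : m.form x (p.proj y) = m.form (p.proj x) (p.proj y) := (p.form_proj_left x _).symm
  conv_lhs => rw [p.decomp y]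
  simp only [map_add, map_smul, smul_eq_mul, h, m.symm x p.e, m.symm x p.f]
  ring

/-- The inner product induced on the orthogonal of a hyperbolic pair. -/
def perpMetric : Metric p.perp where
  form := m.form.restrict p.perp
  symm x y := m.symm x y
  nondegenerate := by
    have h : ∀ x : p.perp, (∀ y : p.perp, m.form x y = 0) → x = 0 := fun x hx =>
      Subtype.ext (m.nondegenerate.1 _ fun y => by
        rw [← p.form_proj_right]; exact hx _)
    exact ⟨h, fun x hx => h x fun y => by rw [m.symm]; exact hx y⟩

@[simp] theorem perpMetric_form (x y : p.perp) : p.perpMetric.form x y = m.form x y := rfl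

/-- The endomorphism of the orthogonal of a hyperbolic pair obtained by compression. -/
def compress (T : Module.End ℝ V) : Module.End ℝ p.perp := p.proj ∘ₗ T ∘ₗ p.perp.subtype

@[simp] theorem compress_apply (T : Module.End ℝ V) (b : p.perp) :
    p.compress T b = p.proj (T b) := rfl

theorem compress_isSkew {T : Module.End ℝ V} (hT : m.IsSkew T) :
    p.perpMetric.IsSkew (p.compress T) := fun x y => by
  simp only [perpMetric_form, compress_apply, form_proj_left, form_proj_right]
  exact hT x y

theorem trace_eq [FiniteDimensional ℝ V] (T : Module.End ℝ V) :
    LinearMap.trace ℝ V T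
      = m.form p.f (T p.e) + m.form p.e (T p.f) + LinearMap.trace ℝ p.perp (p.compress T) := by
  have h : T = (T ∘ₗ p.perp.subtype) ∘ₗ p.proj
      + ((m.form p.f).smulRight (T p.e) + (m.form p.e).smulRight (T p.f)) := by
    ext x
    conv_lhs => rw [p.decomp x]
    simp only [map_add, map_smul, LinearMap.add_apply, LinearMap.comp_apply,
      LinearMap.smulRight_apply, Submodule.subtype_apply]
    abel
  conv_lhs => rw [h]
  rw [map_add, map_add, LinearMap.trace_comp_comm', LinearMap.trace_smulRight,
    LinearMap.trace_smulRight, compress]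
  ring

/-- A vector of negative square in the orthogonal would span, with e - f of square -2, a negative
definite plane, contradicting index one. A nondegenerate semidefinite form is definite. -/
theorem perpMetric_isRiemannian [FiniteDimensional ℝ V] (hm : m.IsLorentzian) :
    p.perpMetric.IsRiemannian := by
  have hnonneg : ∀ x : p.perp, 0 ≤ m.form x x := by
    intro x
    by_contra! hx
    have hform : ∀ s t : ℝ, m.form (s • (x : V) + t • (p.e - p.f)) (s • (x : V) + t • (p.e - p.f))
        = s * s * m.form x x - 2 * (t * t) := by
      intro s t
      simp only [map_add, map_sub, map_smul, LinearMap.add_apply, LinearMap.sub_apply,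
        LinearMap.smul_apply, smul_eq_mul, p.ee, p.ff, p.ef, p.fe, p.e_perp, p.f_perp, p.perp_e,
        p.perp_f]
      ring
    have hneg : ∀ s t : ℝ, s * s * m.form x x - 2 * (t * t) = 0 → s = 0 ∧ t = 0 := by
      intro s t h
      have h1 : s * s * m.form x x ≤ 0 :=
        mul_nonpos_of_nonneg_of_nonpos (mul_self_nonneg s) hx.le
      have h2 := mul_self_nonneg t
      have h3 : t * t = 0 := by linarith
      have h4 : s * s * m.form x x = 0 := by linarith
      exact ⟨by simpa [hx.ne] using h4, by simpa using h3⟩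
    have hli : LinearIndependent ℝ ![(x : V), p.e - p.f] := by
      rw [LinearIndependent.pair_iff]
      intro s t h
      apply hneg
      rw [← hform, h]
      simp
    have hpd : ((-m.form.toQuadraticMap).restrict
        (Submodule.span ℝ (Set.range ![(x : V), p.e - p.f]))).PosDef := by
      rintro ⟨y, hy⟩ hy0
      rw [Matrix.range_cons, Matrix.range_cons, Matrix.range_empty, Set.union_empty] at hy
      obtain ⟨s, t, rfl⟩ := Submodule.mem_span_pair.1 hy
      change 0 < -m.form _ _
      rw [hform]
      have h1 : s * s * m.form x x ≤ 0 :=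
        mul_nonpos_of_nonneg_of_nonpos (mul_self_nonneg s) hx.le
      have h2 := mul_self_nonneg t
      rw [neg_pos]
      refine lt_of_le_of_ne (by linarith) fun h => hy0 ?_
      obtain ⟨rfl, rfl⟩ := hneg s t h
      simp
    have h1 := le_sigNeg_of_negDef _ hpd
    rw [finrank_span_eq_card hli, hm] at h1
    simp at h1
  intro x hx
  refine lt_of_le_of_ne (hnonneg x) fun h0 => hx ?_
  apply p.perpMetric.nondegenerate.1
  intro y
  simp only [perpMetric_form] at h0 ⊢
  by_contra hxy
  -- The Cauchy–Schwarz perturbation; the added 1 keeps the denominator positive even when y is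
  -- null.
  have h1 := hnonneg (x - (m.form x y / (m.form y y + 1)) • y)
  have hy := hnonneg y
  have h2 : m.form y x = m.form x y := m.symm _ _
  simp only [Submodule.coe_sub, Submodule.coe_smul, map_sub, map_smul, LinearMap.sub_apply,
    LinearMap.smul_apply, smul_eq_mul, ← h0, h2] at h1
  have h3 : 0 < m.form x y * m.form x y := mul_self_pos.2 hxy
  have h4 : 0 < m.form y y + 1 := by linarith
  have h5 : 0 - m.form x y / (m.form y y + 1) * m.form x y
      - m.form x y / (m.form y y + 1)
        * (m.form x y - m.form x y / (m.form y y + 1) * m.form y y)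
      = -(m.form x y * m.form x y) * (m.form y y + 2) / (m.form y y + 1) ^ 2 := by
    field_simp; ring
  rw [h5] at h1
  have h6 : -(m.form x y * m.form x y) * (m.form y y + 2) / (m.form y y + 1) ^ 2 < 0 := by
    apply div_neg_of_neg_of_pos
    · nlinarith
    · positivity
  linarith

end NullPair

end NullPair

/-! ### Trace identities for the modular vector -/

section Flat

variable {g : Type u} [LieRing g] [LieAlgebra ℝ g] [FiniteDimensional ℝ g] {m : Metric g}

theorem R_apply (m : Metric g) (u v : g) : m.R u v = m.L v u := rfl

theorem IsFlat.L_lie (hm : m.IsFlat) (u v : g) : m.L ⁅u, v⁆ = ⁅m.L u, m.L v⁆ :=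
  sub_eq_zero.1 (hm u v)

theorem IsFlat.L_lie_apply (hm : m.IsFlat) (u v w : g) :
    m.L ⁅u, v⁆ w = m.L u (m.L v w) - m.L v (m.L u w) := by
  rw [hm.L_lie]; rfl

/-- Here ad u = L_u - R_u, and the skew map L_u is traceless. -/
theorem form_modularVector_eq_neg_trace_R (m : Metric g) (u : g) :
    m.form m.modularVector u = -LinearMap.trace ℝ g (m.R u) := by
  have h : (LieAlgebra.ad ℝ g u : Module.End ℝ g) = m.L u - m.R u := by
    ext v
    rw [LieAlgebra.ad_apply, ← m.L_sub_L]; rfl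
  rw [m.form_modularVector, h, map_sub, (m.L_skew u).trace_eq_zero, zero_sub]

/-- Flatness read as an identity in the left argument w, with [w, u] = w.u - u.w. Its trace makes
the trace form of right multiplications computable from the modular vector. -/
theorem IsFlat.R_L (hm : m.IsFlat) (u v : g) :
    m.R (m.L u v) = m.R v * m.R u + ⁅m.L u, m.R v⁆ := by
  ext w
  have h := hm.L_lie_apply w u v
  rw [← m.L_sub_L, map_sub, LinearMap.sub_apply] at h
  simp only [R_apply, LinearMap.add_apply, Module.End.mul_apply, Ring.lie_def,
    LinearMap.sub_apply]
  rw [eq_comm, sub_eq_iff_eq_add] at h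
  rw [h]; abel

theorem IsFlat.trace_R_mul_R (hm : m.IsFlat) (u v : g) :
    LinearMap.trace ℝ g (m.R v * m.R u) = -m.form m.modularVector (m.L u v) := by
  rw [form_modularVector_eq_neg_trace_R, hm.R_L, map_add, LinearMap.trace_lie]
  ring

theorem form_modularVector_lie (m : Metric g) (u v : g) :
    m.form m.modularVector ⁅u, v⁆ = 0 := by
  have h : (LieAlgebra.ad ℝ g ⁅u, v⁆ : Module.End ℝ g)
      = LieAlgebra.ad ℝ g u * LieAlgebra.ad ℝ g v - LieAlgebra.ad ℝ g v * LieAlgebra.ad ℝ g u := by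
    ext w
    simp
  rw [m.form_modularVector, h, map_sub, LinearMap.trace_mul_comm, sub_self]

theorem IsFlat.form_L_modularVector (hm : m.IsFlat) (u v : g) :
    m.form (m.L u m.modularVector) v = LinearMap.trace ℝ g (m.R u * m.R v) := by
  rw [LinearMap.trace_mul_comm, hm.trace_R_mul_R, m.L_skew]

theorem IsFlat.form_L_modularVector_comm (hm : m.IsFlat) (u v : g) :
    m.form (m.L u m.modularVector) v = m.form u (m.L v m.modularVector) := by
  rw [m.symm u, hm.form_L_modularVector, hm.form_L_modularVector, LinearMap.trace_mul_comm]

theorem IsFlat.L_modularVector_self (hm : m.IsFlat) :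
    m.L m.modularVector m.modularVector = 0 := by
  apply m.ext_form
  intro w
  rw [hm.form_L_modularVector_comm, ← neg_neg (m.form _ (m.L w _)), ← m.L_skew,
    (m.L_skew w).apply_self]
  simp

/-- As h.h = 0, `IsFlat.R_L` becomes R_h² = [R_h, L_h], so R_h is nilpotent and traceless. -/
theorem IsFlat.modularVector_null (hm : m.IsFlat) :
    m.form m.modularVector m.modularVector = 0 := by
  have h1 := hm.R_L m.modularVector m.modularVector
  have h0 : m.R 0 = 0 := map_zero m.L.flip
  rw [hm.L_modularVector_self, h0, Ring.lie_def] at h1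
  have h2 : IsNilpotent (m.R m.modularVector) := by
    apply isNilpotent_of_commutator_eq_sq (A := m.L m.modularVector)
    rw [sub_eq_iff_eq_add, ← sub_eq_zero, ← neg_eq_zero, h1]
    abel
  rw [form_modularVector_eq_neg_trace_R,
    (LinearMap.isNilpotent_trace_of_isNilpotent h2).eq_zero, neg_zero]

end Flat
end Metric
end FlatLie

/-! ### The modular vector of a Lorentzian flat algebra -/

namespace FlatLie

namespace Metric

/-- The hypotheses remove the f-component of T b and the contribution of its e-component. -/
theorem NullPair.compress_mul {V : Type u} [AddCommGroup V] [Module ℝ V] {m : Metric V}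
    (p : NullPair m) {S T : Module.End ℝ V} (hS : p.proj (S p.e) = 0)
    (hT : ∀ b : p.perp, m.form p.e (T b) = 0) :
    p.compress (S * T) = p.compress S * p.compress T := by
  ext1 b
  simp only [compress_apply, Module.End.mul_apply]
  conv_lhs => rw [p.decomp (T b), hT]
  simp [hS]

theorem mem_orthogonal_span {V : Type u} [AddCommGroup V] [Module ℝ V] (m : Metric V)
    (e x : V) :
    x ∈ m.form.orthogonal (Submodule.span ℝ {e}) ↔ m.form e x = 0 := by
  rw [LinearMap.BilinForm.mem_orthogonal_iff]
  constructor
  · exact fun h => h e (Submodule.mem_span_singleton_self e)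
  · intro h y hy
    obtain ⟨t, rfl⟩ := Submodule.mem_span_singleton.1 hy
    simp [h]

variable {g : Type u} [LieRing g] [LieAlgebra ℝ g] [FiniteDimensional ℝ g] {m : Metric g}

/-- In a Lorentzian flat Lie algebra the modular vector spans a left ideal, on which the
orthogonal of the modular vector acts trivially. -/
theorem IsFlat.L_apply_modularVector (hm : m.IsFlat) (hL : m.IsLorentzian) (p : NullPair m)
    (hp : p.e = m.modularVector) (u : g) :
    m.L u p.e = (m.form p.f (m.L p.f p.e) * m.form p.e u) • p.e := by
  have hR := p.perpMetric_isRiemannian hL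
  have hsym : ∀ u v, m.form (m.L u p.e) v = m.form u (m.L v p.e) := by
    rw [hp]; exact hm.form_L_modularVector_comm
  have hee : m.L p.e p.e = 0 := by rw [hp]; exact hm.L_modularVector_self
  have heR : ∀ u, m.form p.e (m.L u p.e) = 0 := fun u => by
    rw [m.symm]; exact (m.L_skew u).apply_self _
  have hcomp : p.compress (m.R p.e) = 0 := by
    apply hR.symmetric_eq_zero
    · intro x y
      simp only [NullPair.perpMetric_form, NullPair.compress_apply, NullPair.form_proj_left,
        NullPair.form_proj_right]
      exact hsym x y
    · rw [← p.compress_mul (by simp [R_apply, hee]) (fun b => heR b)]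
      have h1 := p.trace_eq (m.R p.e * m.R p.e)
      have h2 := hm.trace_R_mul_R p.e p.e
      rw [hee, map_zero, neg_zero] at h2
      simpa [h2, R_apply, hee, heR] using h1.symm
  have hb : ∀ b : p.perp, m.L b p.e = m.form b (m.L p.f p.e) • p.e := by
    intro b
    have h1 : p.proj (m.L b p.e) = 0 := LinearMap.congr_fun hcomp b
    have h2 := p.decomp (m.L b p.e)
    rw [h1, heR, m.symm, hsym] at h2
    simpa using h2
  have hspan : ∀ u, m.form p.e u = 0 → ∃ t : ℝ, m.L u p.e = t • p.e := by
    intro u hu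
    refine ⟨m.form (p.proj u) (m.L p.f p.e), ?_⟩
    conv_lhs => rw [p.decomp u, hu]
    simp [hee, hb]
  set α := m.form p.f (m.L p.f p.e) with hα
  obtain ⟨c, hc⟩ : ∃ c : p.perp, c = p.proj (m.L p.f p.e) := ⟨_, rfl⟩
  have hfe : m.L p.f p.e = α • p.e + c := by
    conv_lhs => rw [p.decomp (m.L p.f p.e), heR]
    simp [hc, hα]
  have hce : m.L c p.e = m.form c c • p.e := by
    rw [hb, hfe]; simp [p.perp_e]
  -- Flatness for (c, f) applied to e, paired with c, leaves only ⟨c,c⟩² = 0.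
  have hc0 : c = 0 := by
    apply hR.eq_zero
    have h1 := hm.L_lie_apply c p.f p.e
    obtain ⟨t, ht⟩ := hspan ⁅(c : g), p.f⁆ (by rw [hp, m.form_modularVector_lie])
    have h2 : m.form (m.L c c) c = 0 := (m.L_skew c).apply_self _
    have h3 := congrArg (fun x => m.form x c) h1
    simp only [ht, hfe, hce, map_add, map_sub, map_smul, LinearMap.add_apply,
      LinearMap.sub_apply, LinearMap.smul_apply, smul_eq_mul, p.e_perp, h2] at h3
    simpa using h3
  rw [hc0] at hfe
  conv_lhs => rw [p.decomp u]
  simp only [map_add, map_smul, LinearMap.add_apply, LinearMap.smul_apply, hee, hb, hfe]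
  simp [p.perp_e, smul_smul, mul_comm]

/-- The hyperbolic pair of a Lorentzian flat Lie algebra with modular first vector can be chosen
such that left multiplication by the modular vector kills the second vector. -/
theorem IsFlat.exists_nullPair_L_eq_zero (hm : m.IsFlat) (hL : m.IsLorentzian) (p : NullPair m)
    (hp : p.e = m.modularVector) :
    ∃ q : NullPair m, q.e = m.modularVector ∧ m.L q.e q.f = 0 := by
  have hee : m.L p.e p.e = 0 := by rw [hp]; exact hm.L_modularVector_self
  have heL : ∀ u, m.form p.e (m.L p.e u) = 0 := fun u => by
    rw [m.symm, m.L_skew, hee]; simp [m.symm u]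
  -- Replacing f by f - y puts the projection of a = e.f in the kernel of the compressed L_e. Then
  -- e.a = -⟨a,a⟩e, and flatness for (e, a) on the new f, paired with a, yields ⟨a,a⟩² = 0.
  obtain ⟨y, hy⟩ := (p.perpMetric_isRiemannian hL).exists_skew_skew_eq
    (p.compress_isSkew (m.L_skew p.e)) (p.proj (m.L p.e p.f))
  let q := NullPair.mk' m p.e (p.f - y) p.ee (by simp [p.ef, p.e_perp])
  have hqe : q.e = p.e := rfl
  have hqf : q.f = p.f - y - (m.form (p.f - y) (p.f - y) / 2) • p.e := rfl
  refine ⟨q, hp, ?_⟩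
  obtain ⟨a, ha⟩ : ∃ a, a = m.L q.e q.f := ⟨_, rfl⟩
  have ha' : a = m.L p.e p.f - m.L p.e y := by simp [ha, hqe, hqf, hee]
  have hea : m.form p.e a = 0 := by rw [ha, hqe, heL]
  have hproj : p.proj (m.L p.e a) = 0 := by
    have h1 : m.L p.e a = m.L p.e (p.proj a) := by
      conv_lhs => rw [p.decomp a, hea]
      simp [hee]
    rw [h1, ha', map_sub, Submodule.coe_sub, map_sub, map_sub, sub_eq_zero]
    exact hy.symm
  obtain ⟨s, hs⟩ : ∃ s : ℝ, m.L p.e a = s • p.e := by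
    refine ⟨m.form p.f (m.L p.e a), ?_⟩
    have h1 := p.decomp (m.L p.e a)
    rw [hproj, heL] at h1
    simpa using h1
  have hsa : s = -m.form a a := by
    have h1 := m.L_skew p.e a q.f
    rw [hs, ← hqe, ← ha] at h1
    simpa [q.ef] using h1
  have hae : m.L a p.e = 0 := by
    rw [hm.L_apply_modularVector hL p hp, hea]; simp
  have hflat := hm.L_lie_apply p.e a q.f
  rw [← m.L_sub_L, hs, hae, sub_zero, map_smul, LinearMap.smul_apply, ← hqe, ← ha] at hflat
  have h1 := congrArg (fun x => m.form x a) hflat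
  have h2 : m.form (m.L a a) a = 0 := (m.L_skew a).apply_self _
  have h3 : m.form (m.L q.e (m.L a q.f)) a = 0 := by
    rw [m.L_skew, hqe, hs, map_smul, m.L_skew, hae]; simp
  simp only [map_sub, map_smul, LinearMap.sub_apply, LinearMap.smul_apply, smul_eq_mul, h2, h3,
    hsa] at h1
  have h4 : m.form a a = 0 := by simpa using h1
  have hfa : m.form q.f a = 0 := by
    rw [ha, m.symm]; exact (m.L_skew _).apply_self _
  have h5 := (q.perpMetric_isRiemannian hL).eq_zero (x := ⟨a, q.mem_perp.2 ⟨hea, hfa⟩⟩) h4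
  rw [← ha]
  exact congrArg Subtype.val h5

theorem IsFlat.proj_L_modularVector (hm : m.IsFlat) (hL : m.IsLorentzian) (p : NullPair m)
    (hp : p.e = m.modularVector) (u : g) : p.proj (m.L u p.e) = 0 := by
  rw [hm.L_apply_modularVector hL p hp, map_smul, p.proj_e, smul_zero]

theorem IsFlat.form_modularVector_L (hm : m.IsFlat) (hL : m.IsLorentzian) (p : NullPair m)
    (hp : p.e = m.modularVector) {v : g} (hv : m.form p.e v = 0) (u : g) :
    m.form p.e (m.L u v) = 0 := by
  rw [m.symm, m.L_skew, hm.L_apply_modularVector hL p hp, map_smul, m.symm v, hv]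
  simp

theorem IsFlat.proj_L (hm : m.IsFlat) (hL : m.IsLorentzian) (p : NullPair m)
    (hp : p.e = m.modularVector) {v : g} (hv : m.form p.e v = 0) (u : g) :
    p.proj (m.L u v) = p.compress (m.L u) (p.proj v) := by
  conv_lhs => rw [p.decomp v, hv]
  simp [hm.proj_L_modularVector hL p hp]

/-- Left multiplications preserve h^⊥ and ℝh, so compression is the induced representation on the
quotient. -/
theorem IsFlat.compress_L_lie (hm : m.IsFlat) (hL : m.IsLorentzian) (p : NullPair m)
    (hp : p.e = m.modularVector) (u v : g) :
    p.compress (m.L ⁅u, v⁆) = ⁅p.compress (m.L u), p.compress (m.L v)⁆ := by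
  have h : ∀ u v, p.compress (m.L u * m.L v) = p.compress (m.L u) * p.compress (m.L v) :=
    fun u v => p.compress_mul (hm.proj_L_modularVector hL p hp u)
      fun b => hm.form_modularVector_L hL p hp (p.e_perp b) v
  rw [Ring.lie_def, ← h, ← h, hm.L_lie]
  ext1 b
  simp [Ring.lie_def]

/-- The isotropy representation kills the brackets of the modular vector with its orthogonal. -/
theorem IsFlat.compress_L_modularVector_lie (hm : m.IsFlat) (hL : m.IsLorentzian) (p : NullPair m)
    (hp : p.e = m.modularVector) {u : g} (hu : m.form p.e u = 0) :
    p.compress (m.L ⁅p.e, u⁆) = 0 := by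
  let I : LieSubalgebra ℝ g :=
    { LinearMap.ker (m.form p.e) with
      lie_mem' := fun {x y} _ _ => by
        change m.form p.e ⁅x, y⁆ = 0
        rw [hp, m.form_modularVector_lie] }
  let ρ : I →ₗ[ℝ] Module.End ℝ p.perp :=
    { toFun := fun u => p.compress (m.L u)
      map_add' := fun u v => by ext1; simp
      map_smul' := fun c u => by ext1; simp }
  refine (p.perpMetric_isRiemannian hL).cocycle_lie_eq_zero ρ
    (fun u v => hm.compress_L_lie hL p hp u v) (fun u => p.compress_isSkew (m.L_skew u))
    (p.proj ∘ₗ I.toSubmodule.subtype) (fun b => ⟨⟨b, p.e_perp b⟩, p.proj_coe b⟩) ?_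
    (h := ⟨p.e, p.ee⟩) p.proj_e ?_ ⟨u, hu⟩
  · rintro ⟨u, hu⟩ ⟨v, hv⟩
    change p.proj ⁅u, v⁆ = p.compress (m.L u) (p.proj v) - p.compress (m.L v) (p.proj u)
    rw [← hm.proj_L hL p hp hv, ← hm.proj_L hL p hp hu, ← map_sub, m.L_sub_L]
  · rintro ⟨u, hu⟩ hu'
    refine ⟨m.form p.f u, Subtype.ext ?_⟩
    have h1 := p.decomp u
    change p.proj u = 0 at hu'
    change m.form p.e u = 0 at hu
    rw [hu', hu] at h1
    simpa using h1

/-- Left multiplication by the modular vector of a nonunimodular Lorentzian flat Lie algebra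
vanishes. -/
theorem IsFlat.L_modularVector_eq_zero (hm : m.IsFlat) (hL : m.IsLorentzian)
    (hh : m.modularVector ≠ 0) : m.L m.modularVector = 0 := by
  obtain ⟨p, hp, hef⟩ : ∃ p : NullPair m, p.e = m.modularVector ∧ m.L p.e p.f = 0 := by
    obtain ⟨y, hy⟩ := m.exists_form_eq_one hh
    exact hm.exists_nullPair_L_eq_zero hL (NullPair.mk' m _ y hm.modularVector_null hy) rfl
  have hR := p.perpMetric_isRiemannian hL
  have hee : m.L p.e p.e = 0 := by rw [hp]; exact hm.L_modularVector_self
  rw [← hp]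
  by_cases hA : p.compress (m.L p.e) = 0
  · ext1 x
    have h1 := p.decomp (m.L p.e x)
    have h2 : p.proj (m.L p.e x) = 0 := by
      have h3 : p.proj (m.L p.e (p.proj x)) = 0 := LinearMap.congr_fun hA (p.proj x)
      rw [p.decomp x]
      simp [hee, hef, h3]
    have h3 : m.form p.e (m.L p.e x) = 0 := by rw [m.symm, m.L_skew, hee]; simp [m.symm x]
    have h4 : m.form p.f (m.L p.e x) = 0 := by rw [m.symm, m.L_skew, hef]; simp [m.symm x]
    rw [h2, h3, h4] at h1
    simpa using h1
  exfalso
  set A := p.compress (m.L p.e) with hAdef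
  have hτ : LinearMap.trace ℝ p.perp (A * A) ≠ 0 := fun h =>
    hA (hR.skew_eq_zero (p.compress_isSkew (m.L_skew p.e)) h)
  -- Invariance of the trace form: tr(A[X, Y]) = tr([A, X]Y).
  have htrace : ∀ u v, LinearMap.trace ℝ p.perp (A * p.compress (m.L ⁅u, v⁆))
      = LinearMap.trace ℝ p.perp (p.compress (m.L ⁅p.e, u⁆) * p.compress (m.L v)) := by
    intro u v
    rw [hm.compress_L_lie hL p hp, hm.compress_L_lie hL p hp, Ring.lie_def, Ring.lie_def, mul_sub,
      sub_mul, map_sub, map_sub, ← hAdef, mul_assoc, mul_assoc,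
      LinearMap.trace_mul_comm ℝ (p.compress (m.L u)), mul_assoc]
  -- As [e, f] = -αe, the invariance at (e, f) reads -α tr(A²) = 0.
  have hα : ∀ u, m.L u p.e = 0 := by
    have h1 := htrace p.e p.f
    have h2 : ⁅p.e, p.f⁆ = -m.form p.f (m.L p.f p.e) • p.e := by
      rw [← m.L_sub_L, hef, hm.L_apply_modularVector hL p hp, p.ef]; simp [p.fe]
    have h3 : p.compress (m.L ⁅p.e, p.f⁆) = -m.form p.f (m.L p.f p.e) • A := by
      rw [h2]; ext1; simp [A]
    have h4 : p.compress (m.L ⁅p.e, p.e⁆) = 0 := by ext1; simp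
    rw [h3, h4, zero_mul, map_zero, mul_smul_comm, map_smul, smul_eq_mul, mul_eq_zero] at h1
    have h5 := h1.resolve_right hτ
    intro u
    rw [hm.L_apply_modularVector hL p hp, neg_eq_zero.1 h5]; simp
  let φ : Module.Dual ℝ g :=
    { toFun := fun u => LinearMap.trace ℝ p.perp (A * p.compress (m.L u))
        / LinearMap.trace ℝ p.perp (A * A)
      map_add' := fun u v => by
        have : p.compress (m.L (u + v)) = p.compress (m.L u) + p.compress (m.L v) := by
          ext1; simp
        rw [this, mul_add, map_add, add_div]
      map_smul' := fun c u => by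
        have : p.compress (m.L (c • u)) = c • p.compress (m.L u) := by ext1; simp
        rw [this, mul_smul_comm, map_smul, smul_eq_mul, mul_div_assoc]; rfl }
  -- The division by tr(A²) normalises ⟨e, y⟩ to 1.
  obtain ⟨y, hy⟩ := (m.form.toDual m.nondegenerate).surjective φ
  have hy' : ∀ u, m.form y u = LinearMap.trace ℝ p.perp (A * p.compress (m.L u))
      / LinearMap.trace ℝ p.perp (A * A) := fun u => LinearMap.congr_fun hy u
  have hylie : ∀ u v, m.form p.e u = 0 → m.form y ⁅u, v⁆ = 0 := by
    intro u v hu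
    rw [hy', htrace, hm.compress_L_modularVector_lie hL p hp hu, zero_mul, map_zero, zero_div]
  have hey : m.form p.e y = 1 := by rw [m.symm, hy', div_self hτ]
  let q := NullPair.mk' m p.e y p.ee hey
  have hqe : q.e = p.e := rfl
  have hqf : q.f = y - (m.form y y / 2) • p.e := rfl
  have hLef : m.L q.e q.f = 0 := by
    rw [hqe, hqf, map_sub, map_smul, hee, smul_zero, sub_zero]
    apply m.ext_form
    intro w
    have h1 : m.L p.e w = -⁅(p.proj w : g), p.e⁆ := by
      rw [← m.L_sub_L, hα]
      conv_lhs => rw [p.decomp w]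
      simp [hee, hef]
    rw [m.L_skew, h1, map_neg, hylie _ _ (p.e_perp _)]
    simp
  have hqlie : ∀ u v, m.form q.e u = 0 → m.form q.f ⁅u, v⁆ = 0 := by
    intro u v hu
    rw [hqf, map_sub, LinearMap.sub_apply, hylie u v hu, map_smul, LinearMap.smul_apply, hp,
      m.form_modularVector_lie]
    simp
  have heR : ∀ u v, m.form q.e (m.L u v) = 0 := by
    intro u v
    rw [m.symm, m.L_skew, hqe, hα]; simp
  -- Orthogonality of the new f to [e^⊥, g] makes this compression symmetric; tr(R_f²) = -⟨e, f.f⟩ =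
  -- 0 then kills it.
  have hcomp : q.compress (m.R q.f) = 0 := by
    apply (q.perpMetric_isRiemannian hL).symmetric_eq_zero
    · intro x z
      simp only [NullPair.perpMetric_form, NullPair.compress_apply, NullPair.form_proj_left,
        NullPair.form_proj_right, R_apply]
      rw [m.symm x, m.L_skew, m.L_skew, neg_inj, ← sub_eq_zero, ← map_sub, m.L_sub_L,
        hqlie _ _ (q.e_perp x)]
    · rw [← q.compress_mul (by simp [R_apply, hLef]) (fun b => heR b _)]
      have h1 := q.trace_eq (m.R q.f * m.R q.f)
      rw [hm.trace_R_mul_R, ← hp, ← hqe, heR] at h1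
      simpa [R_apply, hLef, heR] using h1.symm
  have h1 := q.trace_eq (m.R q.f)
  have h2 := m.form_modularVector_eq_neg_trace_R q.f
  rw [hcomp, map_zero, R_apply, R_apply, hLef, heR, map_zero] at h1
  rw [h1, ← hp, ← hqe, q.ef] at h2
  norm_num at h2

theorem modularVector_ne_zero (m : Metric g) (h : ¬ IsUnimodular g) : m.modularVector ≠ 0 :=
  fun h0 => h fun u => by rw [← m.form_modularVector, h0]; simp

theorem IsFlat.isTwoSidedIdeal_span (hm : m.IsFlat) (hL : m.IsLorentzian)
    (hh : m.modularVector ≠ 0) :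
    m.IsTwoSidedIdeal (Submodule.span ℝ {m.modularVector}) := by
  obtain ⟨y, hy⟩ := m.exists_form_eq_one hh
  let p := NullPair.mk' m _ y hm.modularVector_null hy
  intro u x hx
  obtain ⟨t, rfl⟩ := Submodule.mem_span_singleton.1 hx
  have h1 : m.L u m.modularVector = _ := hm.L_apply_modularVector hL p rfl u
  rw [map_smul, map_smul, hm.L_modularVector_eq_zero hL hh, h1]
  exact ⟨Submodule.smul_mem _ _ (Submodule.smul_mem _ _ (Submodule.mem_span_singleton_self _)),
    by simp⟩

theorem IsFlat.isTwoSidedIdeal_orthogonal (hm : m.IsFlat) (hL : m.IsLorentzian)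
    (hh : m.modularVector ≠ 0) :
    m.IsTwoSidedIdeal (m.form.orthogonal (Submodule.span ℝ {m.modularVector})) := by
  obtain ⟨y, hy⟩ := m.exists_form_eq_one hh
  let p := NullPair.mk' m _ y hm.modularVector_null hy
  intro u x hx
  rw [mem_orthogonal_span] at hx ⊢
  rw [mem_orthogonal_span]
  refine ⟨hm.form_modularVector_L hL p rfl hx u, ?_⟩
  rw [m.symm, m.L_skew]
  have h1 : m.L x m.modularVector = _ := hm.L_apply_modularVector hL p rfl x
  have h2 : m.form p.e x = 0 := hx
  rw [h1, h2]
  simp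

end Metric
end FlatLie

/-! ### Reduction by a null ideal, inverse to double extension -/

namespace FlatLie

namespace Metric

variable {g : Type u} [LieRing g] [LieAlgebra ℝ g] [FiniteDimensional ℝ g] {m : Metric g}

/-- A hyperbolic pair of a flat Lie algebra whose first vector spans a two-sided ideal for the
Levi-Civita product, and is annihilated by its own left multiplication. -/
structure IdealPair (m : Metric g) extends NullPair m where
  flat : m.IsFlat
  μ : ℝ
  L_e : m.L e = 0
  L_apply_e : ∀ u, m.L u e = (μ * m.form e u) • e

namespace IdealPair

variable (q : IdealPair m)

theorem form_e_L {v : g} (hv : m.form q.e v = 0) (u : g) : m.form q.e (m.L u v) = 0 := by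
  rw [m.symm, m.L_skew, q.L_apply_e, map_smul, m.symm v, hv]
  simp

theorem form_e_L_left {u : g} (hu : m.form q.e u = 0) (v : g) : m.form q.e (m.L u v) = 0 := by
  rw [m.symm, m.L_skew, q.L_apply_e, hu]
  simp

theorem form_e_lie (u v : g) : m.form q.e ⁅u, v⁆ = 0 := by
  rw [← m.L_sub_L, map_sub, m.symm, m.L_skew, m.symm q.e, m.L_skew, q.L_apply_e, q.L_apply_e]
  simp only [map_smul, LinearMap.smul_apply, smul_eq_mul, m.symm v, m.symm u]
  ring

theorem proj_L {v : g} (hv : m.form q.e v = 0) (u : g) :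
    q.proj (m.L u (q.proj v)) = q.proj (m.L u v) := by
  conv_rhs => rw [q.decomp v, hv]
  simp [q.L_apply_e]

theorem L_proj {u : g} (hu : m.form q.e u = 0) : m.L (q.proj u) = m.L u := by
  conv_rhs => rw [q.decomp u, hu]
  simp [q.L_e]

/-- Dropping the e-component does not affect the projected bracket; the Jacobi identity on the
quotient rests on this. -/
theorem proj_lie_proj {v : g} (hv : m.form q.e v = 0) (a : q.perp) :
    q.proj ⁅(a : g), (q.proj v : g)⁆ = q.proj ⁅(a : g), v⁆ := by
  rw [← m.L_sub_L, ← m.L_sub_L, map_sub, map_sub, q.proj_L hv, q.L_proj hv]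

/-- The Lie algebra structure on the orthogonal of the pair, identified with the quotient of the
orthogonal of the first vector by its span. -/
instance : LieRing q.toNullPair.perp where
  bracket a b := q.proj ⁅(a : g), (b : g)⁆
  add_lie a b c := by
    change q.proj _ = q.proj _ + q.proj _
    rw [← map_add, ← add_lie]; rfl
  lie_add a b c := by
    change q.proj _ = q.proj _ + q.proj _
    rw [← map_add, ← lie_add]; rfl
  lie_self a := by
    change q.proj _ = 0
    rw [lie_self, map_zero]
  leibniz_lie a b c := by
    change q.proj ⁅(a : g), (q.proj ⁅(b : g), (c : g)⁆ : g)⁆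
      = q.proj ⁅(q.proj ⁅(a : g), (b : g)⁆ : g), (c : g)⁆
        + q.proj ⁅(b : g), (q.proj ⁅(a : g), (c : g)⁆ : g)⁆
    rw [← lie_skew (q.proj ⁅(a : g), (b : g)⁆ : g) (c : g), map_neg, q.proj_lie_proj (q.form_e_lie _ _),
      q.proj_lie_proj (q.form_e_lie _ _), q.proj_lie_proj (q.form_e_lie _ _), ← map_neg,
      lie_skew, ← map_add, ← leibniz_lie]

instance : LieAlgebra ℝ q.toNullPair.perp where
  lie_smul c a b := by
    change q.proj _ = c • q.proj _
    rw [← map_smul, ← lie_smul]; rfl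

theorem lie_eq (a b : q.toNullPair.perp) : ⁅a, b⁆ = q.proj ⁅(a : g), (b : g)⁆ := rfl

/-- The inner product on the orthogonal of the pair. -/
def baseMetric : Metric q.toNullPair.perp := q.toNullPair.perpMetric

theorem baseMetric_form (a b : q.toNullPair.perp) : q.baseMetric.form a b = m.form a b := rfl

theorem baseMetric_L (a b : q.toNullPair.perp) :
    q.baseMetric.L a b = q.proj (m.L a b) := by
  apply q.baseMetric.ext_form
  intro c
  have h1 := q.baseMetric.koszul_formula a b c
  have h2 := m.koszul_formula (a : g) b c
  simp only [baseMetric_form, lie_eq, NullPair.form_proj_left] at h1 ⊢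
  linarith

theorem baseMetric_isFlat : q.baseMetric.IsFlat := by
  intro a b
  ext1 c
  have h := congrArg q.proj (q.flat.L_lie_apply (a : g) b c)
  rw [map_sub] at h
  simp only [curvature, LinearMap.sub_apply, Ring.lie_def, Module.End.mul_apply, baseMetric_L,
    lie_eq, q.L_proj (q.form_e_lie _ _), q.proj_L (q.form_e_L (q.e_perp c) _), h, sub_self,
    LinearMap.zero_apply]

/-- Minus the compression of the right multiplication by the second vector of the pair. -/
noncomputable def ξ : Module.End ℝ q.toNullPair.perp := -q.compress (m.R q.f)

theorem coe_ξ (a : q.toNullPair.perp) : (q.ξ a : g) = -m.L a q.f := by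
  have h1 := q.decomp (m.L a q.f)
  have h2 : m.form q.f (m.L a q.f) = 0 := by rw [m.symm]; exact (m.L_skew _).apply_self _
  rw [q.form_e_L_left (q.e_perp a), h2] at h1
  simp only [zero_smul, zero_add, add_zero] at h1
  rw [h1]; rfl

theorem L_f (a : q.toNullPair.perp) : m.L a q.f = -(q.ξ a : g) := by rw [coe_ξ, neg_neg]

theorem L_f_f : m.L q.f q.f = q.proj (m.L q.f q.f) - q.μ • q.f := by
  have h1 := q.decomp (m.L q.f q.f)
  have h2 : m.form q.f (m.L q.f q.f) = 0 := by rw [m.symm]; exact (m.L_skew _).apply_self _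
  have h3 : m.form q.e (m.L q.f q.f) = -q.μ := by
    rw [m.symm, m.L_skew, q.L_apply_e]; simp [q.ef, q.fe]
  rw [h2, h3] at h1
  conv_lhs => rw [h1]
  module

theorem proj_lie_f (a : q.toNullPair.perp) :
    q.proj ⁅(a : g), q.f⁆ = -(q.ξ a + q.compress (m.L q.f) a) := by
  rw [← m.L_sub_L, L_f, map_sub, map_neg, NullPair.proj_coe, NullPair.compress_apply]
  abel

/-- The admissible quadruple attached to the pair. -/
noncomputable def admissible : AdmissibleData q.baseMetric where
  ξ := q.ξ
  D := q.compress (m.L q.f) + q.ξ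
  μ := q.μ
  b₀ := q.proj (m.L q.f q.f)
  cocycle a b := by
    -- Flatness for (a, b) applied to f.
    have h := congrArg q.proj (q.flat.L_lie_apply (a : g) b q.f)
    rw [← q.L_proj (q.form_e_lie _ _), ← lie_eq, L_f, L_f, L_f] at h
    simp only [map_neg, map_sub, NullPair.proj_coe] at h
    rw [baseMetric_L, baseMetric_L, ← neg_inj, h]
    abel
  skew := by
    rw [add_sub_cancel_right]
    exact q.compress_isSkew (m.L_skew q.f)
  commutator := by
    ext1 a
    -- Flatness for (a, f) applied to f.
    have h := congrArg q.proj (q.flat.L_lie_apply (a : g) q.f q.f)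
    rw [← q.L_proj (q.form_e_lie _ _), proj_lie_f, L_f, L_f, L_f_f] at h
    simp only [map_neg, map_sub, map_add, map_smul, NullPair.proj_coe, L_f] at h
    rw [← baseMetric_L, ← NullPair.compress_apply] at h
    simp only [pow_two, Ring.lie_def, LinearMap.sub_apply, LinearMap.add_apply,
      Module.End.mul_apply, LinearMap.smul_apply, R_apply, map_add]
    rw [← sub_eq_zero] at h ⊢
    rw [← neg_eq_zero, ← h]
    module
  compat a b := by
    -- Flatness for (a, f) applied to b.
    have h := congrArg q.proj (q.flat.L_lie_apply (a : g) q.f b)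
    rw [← q.L_proj (q.form_e_lie _ _), proj_lie_f, map_sub, ← baseMetric_L,
      ← q.proj_L (q.form_e_L (q.e_perp b) _), ← q.proj_L (q.form_e_L (q.e_perp b) (a : g)),
      ← baseMetric_L, ← baseMetric_L, ← NullPair.compress_apply, ← NullPair.compress_apply] at h
    simp only [map_neg, map_add, LinearMap.add_apply, LinearMap.neg_apply] at h ⊢
    rw [← sub_eq_zero] at h ⊢
    rw [← h]
    module

/-- D is the compression of ad f, whose diagonal entries at e and f are μ and 0. -/
theorem trace_D (hf : LinearMap.trace ℝ g (LieAlgebra.ad ℝ g q.f) = 1) :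
    LinearMap.trace ℝ q.toNullPair.perp q.admissible.D = 1 - q.admissible.μ := by
  have h1 := q.trace_eq (LieAlgebra.ad ℝ g q.f)
  have h2 : q.compress (LieAlgebra.ad ℝ g q.f) = q.admissible.D := by
    ext1 a
    change q.proj ⁅q.f, (a : g)⁆ = q.compress (m.L q.f) a + q.ξ a
    rw [← lie_skew, map_neg, proj_lie_f]
    abel
  have h3 : (LieAlgebra.ad ℝ g q.f) q.e = q.μ • q.e := by
    rw [LieAlgebra.ad_apply, ← m.L_sub_L, q.L_e, q.L_apply_e]; simp [q.ef]
  have h4 : (LieAlgebra.ad ℝ g q.f) q.f = 0 := by simp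
  rw [hf, h2, h3, h4, map_smul, q.fe, map_zero] at h1
  have h5 : q.admissible.μ = q.μ := rfl
  rw [h5, h1]
  simp

/-- The coordinates of a vector in the decomposition given by the pair. -/
noncomputable def toDoubleExtension : g ≃ₗ[ℝ] DoubleExtension q.admissible where
  toFun x := ((m.form q.f x, q.proj x, m.form q.e x) : ℝ × q.toNullPair.perp × ℝ)
  invFun y := y.1 • q.e + (y.2.1 : g) + y.2.2 • q.f
  map_add' x y := DoubleExtension.ext' (map_add (m.form q.f) x y) (map_add q.proj x y)
    (map_add (m.form q.e) x y)
  map_smul' c x := DoubleExtension.ext' (map_smul (m.form q.f) c x) (map_smul q.proj c x)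
    (map_smul (m.form q.e) c x)
  left_inv x := (q.decomp x).symm
  right_inv y := by
    apply DoubleExtension.ext' <;>
      simp [q.ee, q.ff, q.ef, q.fe, NullPair.e_perp, NullPair.f_perp]

theorem toDoubleExtension_fst (x : g) : (q.toDoubleExtension x).1 = m.form q.f x := rfl
theorem toDoubleExtension_mid (x : g) : (q.toDoubleExtension x).2.1 = q.proj x := rfl
theorem toDoubleExtension_snd (x : g) : (q.toDoubleExtension x).2.2 = m.form q.e x := rfl

theorem lie_decomp (x y : g) : ⁅x, y⁆
    = q.μ • (m.form q.e x * m.form q.f y - m.form q.e y * m.form q.f x) • q.e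
      + m.form q.e x • ⁅q.f, (q.proj y : g)⁆ - m.form q.e y • ⁅q.f, (q.proj x : g)⁆
      + ⁅(q.proj x : g), (q.proj y : g)⁆ := by
  have h1 : ⁅q.f, q.e⁆ = q.μ • q.e := by
    rw [← m.L_sub_L, q.L_e, q.L_apply_e]; simp [q.ef]
  have h2 : ∀ a : q.perp, ⁅(a : g), q.e⁆ = 0 := fun a => by
    rw [← m.L_sub_L, q.L_e, q.L_apply_e, q.e_perp]; simp
  have h3 : ∀ a : q.perp, ⁅q.e, (a : g)⁆ = 0 := fun a => by rw [← lie_skew, h2, neg_zero]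
  conv_lhs => rw [q.decomp x, q.decomp y]
  simp only [add_lie, lie_add, smul_lie, lie_smul, lie_self, h2, h3, h1]
  rw [← lie_skew q.e q.f, h1, ← lie_skew (q.proj x : g) q.f]
  module

theorem form_f_lie_f (a : q.perp) :
    m.form q.f ⁅q.f, (a : g)⁆ = -m.form (q.proj (m.L q.f q.f)) a := by
  have h : m.form q.f (m.L a q.f) = 0 := by rw [m.symm]; exact (m.L_skew _).apply_self _
  rw [← m.L_sub_L, map_sub, h, sub_zero, NullPair.form_proj_left, m.L_skew, neg_neg]

theorem form_f_lie (a b : q.perp) :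
    m.form q.f ⁅(a : g), (b : g)⁆ = m.form (q.ξ a) b - m.form a (q.ξ b) := by
  rw [← m.L_sub_L, map_sub, coe_ξ, coe_ξ, m.symm, m.L_skew, m.symm q.f, m.L_skew]
  simp only [map_neg, LinearMap.neg_apply, m.symm b]

theorem toDoubleExtension_lie (x y : g) :
    q.toDoubleExtension ⁅x, y⁆ = ⁅q.toDoubleExtension x, q.toDoubleExtension y⁆ := by
  apply DoubleExtension.ext'
  · rw [DoubleExtension.lie_fst]
    simp only [toDoubleExtension_fst, toDoubleExtension_mid, toDoubleExtension_snd,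
      baseMetric_form]
    change _ = q.μ * _ - (_ * m.form (q.proj (m.L q.f q.f)) _
      - _ * m.form (q.proj (m.L q.f q.f)) _) + (m.form (q.ξ _) _ - m.form _ (q.ξ _))
    conv_lhs => rw [q.lie_decomp x y]
    simp only [map_add, map_sub, map_smul, smul_eq_mul, form_f_lie_f, form_f_lie, q.fe]
    ring
  · rw [DoubleExtension.lie_mid]
    simp only [toDoubleExtension_mid, toDoubleExtension_snd, lie_eq]
    have h : ∀ a : q.perp, q.proj ⁅q.f, (a : g)⁆ = q.admissible.D a := fun a => by
      change q.proj ⁅q.f, (a : g)⁆ = q.compress (m.L q.f) a + q.ξ a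
      rw [← lie_skew, map_neg, proj_lie_f]
      abel
    conv_lhs => rw [q.lie_decomp x y]
    simp only [map_add, map_sub, map_smul, NullPair.proj_e, smul_zero, zero_add, h]
  · rw [DoubleExtension.lie_snd, toDoubleExtension_snd, form_e_lie]

theorem toDoubleExtension_isometry (x y : g) :
    (DoubleExtension.metric q.admissible).form (q.toDoubleExtension x) (q.toDoubleExtension y)
      = m.form x y := by
  rw [q.form_eq x y]
  rfl

end IdealPair

theorem IsFlat.exists_idealPair (hm : m.IsFlat) (hL : m.IsLorentzian)
    (hh : m.modularVector ≠ 0) : ∃ q : IdealPair m, q.e = m.modularVector := by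
  obtain ⟨y, hy⟩ := m.exists_form_eq_one hh
  let p := NullPair.mk' m _ y hm.modularVector_null hy
  exact ⟨{ p with
    flat := hm
    μ := m.form p.f (m.L p.f p.e)
    L_e := hm.L_modularVector_eq_zero hL hh
    L_apply_e := hm.L_apply_modularVector hL p rfl }, rfl⟩

end Metric
end FlatLie

/-! ### Assembly of the theorem -/

theorem theorem1p1 {g : Type u} [LieRing g] [LieAlgebra ℝ g] [FiniteDimensional ℝ g]
    (m : FlatLie.Metric g) (hLorentz : m.IsLorentzian) (hFlat : m.IsFlat)
    (hNonunimodular : ¬ FlatLie.IsUnimodular g) :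
    (m.L m.modularVector = 0 ∧
      m.IsTwoSidedIdeal (Submodule.span ℝ {m.modularVector}) ∧
      m.IsTwoSidedIdeal (m.form.orthogonal (Submodule.span ℝ {m.modularVector}))) ∧
    ∃ (B : Type u) (_ : LieRing B) (_ : LieAlgebra ℝ B) (_ : FiniteDimensional ℝ B)
      (m₀ : FlatLie.Metric B) (d : FlatLie.AdmissibleData m₀),
      m₀.IsRiemannian ∧ m₀.IsFlat ∧ LinearMap.trace ℝ B d.D ≠ -d.μ ∧
      ∃ φ : g ≃ₗ⁅ℝ⁆ FlatLie.DoubleExtension d,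
        ∀ x y : g, (FlatLie.DoubleExtension.metric d).form (φ x) (φ y) = m.form x y := by
  have hh := m.modularVector_ne_zero hNonunimodular
  refine ⟨⟨hFlat.L_modularVector_eq_zero hLorentz hh, hFlat.isTwoSidedIdeal_span hLorentz hh,
    hFlat.isTwoSidedIdeal_orthogonal hLorentz hh⟩, ?_⟩
  obtain ⟨q, hq⟩ := hFlat.exists_idealPair hLorentz hh
  refine ⟨q.toNullPair.perp, inferInstance, inferInstance, inferInstance, q.baseMetric,
    q.admissible, q.toNullPair.perpMetric_isRiemannian hLorentz, q.baseMetric_isFlat, ?_,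
    { q.toDoubleExtension with map_lie' := q.toDoubleExtension_lie _ _ },
    q.toDoubleExtension_isometry⟩
  have h : LinearMap.trace ℝ g (LieAlgebra.ad ℝ g q.f) = 1 := by
    rw [← m.form_modularVector, ← hq, q.ef]
  rw [q.trace_D h]
  intro h1
  linarith
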